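/- Let $q=2^r$ with $r\ge 1$, and let $n\ge 1$ be an odd integer. Let $O(2n+1,q)$ be the group of all isometries of the quadratic form $\theta(x)=\sum_{i=1}^{n}x_ix_{n+i}+x_{2n+1}^2$ on $\mathbb{F}_q^{(2n+1)\times 1}$, and let $$P=\left\{\begin{bmatrix}A&0&0\\0&{}^tA^{-1}&0\\0&0&1\end{bmatrix}\begin{bmatrix}1_n&B&0\\0&1_n&0\\0&h&1\end{bmatrix}\ :\ A\in GL(n,q),\ B\in\mathbb{F}_q^{n\times n},\ h\in\mathbb{F}_q^{1\times n},\ B+{}^th\,h\text{ alternating}\right\}\subset O(2n+1,q),$$ where a square matrix is alternating if it is skew-symmetric with zero diagonal. Let $\sigma_{n-1}\in O(2n+1,q)$ be the permutation matrix that exchanges the coordinates $i$ and $n+i$ for $1\le i\le n-1$ and fixes the coordinates $n$, $2n$ and $2n+1$, and let $DC(n,q)=P\sigma_{n-1}P$. Let $g_1,\dots,g_N$, $N=|DC(n,q)|$, be any ordering of the elements of $DC(n,q)$, let $v=(\mathrm{Tr}\,g_1,\dots,\mathrm{Tr}\,g_N)\in\mathbb{F}_q^N$, where $\mathrm{Tr}$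 is the matrix trace, and let $C(DC(n,q))=\{u\in\mathbb{F}_2^N : u\cdot v=0\}$. Let $\mathrm{tr}(x)=x+x^2+\cdots+x^{2^{r-1}}$ be the trace $\mathbb{F}_q\to\mathbb{F}_2$, let $\lambda(x)=(-1)^{\mathrm{tr}(x)}$, and for $a\in\mathbb{F}_q^*$ let $K(\lambda;a)=\sum_{\alpha\in\mathbb{F}_q^*}\lambda(\alpha+a\alpha^{-1})$. Put $$A(n,q)=q^{\frac14(5n^2-1)}\,\frac{q^n-1}{q-1}\prod_{j=1}^{(n-1)/2}(q^{2j-1}-1),\qquad B(n,q)=q^{\frac14(n-1)^2}(q^n-1)\prod_{j=1}^{(n-1)/2}(q^{2j}-1).$$ Then for every $a\in\mathbb{F}_q^*$ the word $c(a)=(\mathrm{tr}(a\,\mathrm{Tr}\,g_1),\dots,\mathrm{tr}(a\,\mathrm{Tr}\,g_N))\in\mathbb{F}_2^N$ belongs to the dual code $C(DC(n,q))^{\perp}$, and its Hamming weight is $$w(c(a))=\tfrac12\,A(n,q)\bigl(B(n,q)-\lambda(a)K(\lambda;a)\bigr).$$ -/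

import Mathlib

open scoped Matrix

namespace OddOrthogonalCode

/-- Index set of the `2n+1` coordinates: the first block of `n`, the second block of `n`,
and the last coordinate. -/
abbrev Idx (n : ℕ) : Type := (Fin n ⊕ Fin n) ⊕ Fin 1

/-- The quadratic form `θ(x) = ∑ᵢ xᵢ x_{n+i} + x_{2n+1}²` on column vectors of length `2n+1`. -/
def theta (n : ℕ) {F : Type*} [Field F] (x : Idx n → F) : F :=
  ∑ i : Fin n, x (Sum.inl (Sum.inl i)) * x (Sum.inl (Sum.inr i)) + x (Sum.inr 0) ^ 2

/-- The orthogonal group `O(2n+1, q)`: the group of all isometries of `θ`. -/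
def O (n : ℕ) (F : Type*) [Field F] : Subgroup (GL (Idx n) F) where
  carrier := {g | ∀ x : Idx n → F, theta n ((g : Matrix (Idx n) (Idx n) F) *ᵥ x) = theta n x}
  one_mem' := by intro x; simp
  mul_mem' := by
    intro a b ha hb x
    have h := ha ((b : Matrix (Idx n) (Idx n) F) *ᵥ x)
    rw [Matrix.mulVec_mulVec] at h
    rw [Units.val_mul, h]
    exact hb x
  inv_mem' := by
    intro a ha x
    have h := ha (((a⁻¹ : GL (Idx n) F) : Matrix (Idx n) (Idx n) F) *ᵥ x)
    rw [Matrix.mulVec_mulVec, ← Units.val_mul, mul_inv_cancel, Units.val_one,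
      Matrix.one_mulVec] at h
    exact h.symm

/-- The underlying matrix of an element of `O(2n+1, q)`. -/
def toMat {n : ℕ} {F : Type*} [Field F] (w : O n F) : Matrix (Idx n) (Idx n) F :=
  ((w : GL (Idx n) F) : Matrix (Idx n) (Idx n) F)

/-- A square matrix is alternating if it has zero diagonal and is skew-symmetric. -/
def IsAlternating {n : ℕ} {F : Type*} [Field F] (X : Matrix (Fin n) (Fin n) F) : Prop :=
  (∀ i, X i i = 0) ∧ ∀ i j, X i j = -X j i

/-- The block matrix `[A 0 0; 0 ᵗA⁻¹ 0; 0 0 1]`. -/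
def levi {n : ℕ} {F : Type*} [Field F] (A : GL (Fin n) F) : Matrix (Idx n) (Idx n) F :=
  Matrix.fromBlocks
    (Matrix.fromBlocks (A : Matrix (Fin n) (Fin n) F) 0 0
      ((A⁻¹ : GL (Fin n) F) : Matrix (Fin n) (Fin n) F)ᵀ)
    0 0 1

/-- The block matrix `[1 B 0; 0 1 0; 0 h 1]`. -/
def unip {n : ℕ} {F : Type*} [Field F] (B : Matrix (Fin n) (Fin n) F)
    (h : Matrix (Fin 1) (Fin n) F) : Matrix (Idx n) (Idx n) F :=
  Matrix.fromBlocks (Matrix.fromBlocks 1 B 0 1) 0 (Matrix.fromCols 0 h) 1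

/-- The underlying set of the maximal parabolic subgroup `P = P(2n+1, q)` of `O(2n+1, q)`. -/
def P (n : ℕ) (F : Type*) [Field F] : Set (O n F) :=
  {w | ∃ (A : GL (Fin n) F) (B : Matrix (Fin n) (Fin n) F) (h : Matrix (Fin 1) (Fin n) F),
    IsAlternating (B + hᵀ * h) ∧ toMat w = levi A * unip B h}

/-- The matrix of `σ_r` (for `0 ≤ r ≤ n`), with block rows
`[0 0 1_r 0 0]`, `[0 1_{n-r} 0 0 0]`, `[1_r 0 0 0 0]`, `[0 0 0 1_{n-r} 0]`, `[0 0 0 0 1]`: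
it exchanges coordinates `i` and `n+i` for `i ≤ r` and fixes all the others. -/
def sigmaMat (n r : ℕ) (F : Type*) [Field F] : Matrix (Idx n) (Idx n) F :=
  Matrix.fromBlocks
    (Matrix.fromBlocks
      (Matrix.diagonal fun i => if i.val < r then 0 else 1)
      (Matrix.diagonal fun i => if i.val < r then 1 else 0)
      (Matrix.diagonal fun i => if i.val < r then 1 else 0)
      (Matrix.diagonal fun i => if i.val < r then 0 else 1))
    0 0 1

theorem sigmaMat_mul_self (n r : ℕ) (F : Type*) [Field F] :
    sigmaMat n r F * sigmaMat n r F = 1 := by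
  simp only [sigmaMat, Matrix.fromBlocks_multiply, Matrix.diagonal_mul_diagonal,
    Matrix.diagonal_add, Matrix.mul_zero, Matrix.zero_mul, add_zero, zero_add, mul_one]
  rw [← Matrix.fromBlocks_one, ← Matrix.fromBlocks_one]
  congr 2
  · rw [← Matrix.diagonal_one]; congr 1; funext i; split_ifs <;> simp
  · rw [← Matrix.diagonal_zero]; congr 1; funext i; split_ifs <;> simp
  · rw [← Matrix.diagonal_zero]; congr 1; funext i; split_ifs <;> simp
  · rw [← Matrix.diagonal_one]; congr 1; funext i; split_ifs <;> simp

theorem theta_sigmaMat (n r : ℕ) {F : Type*} [Field F] (x : Idx n → F) :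
    theta n (sigmaMat n r F *ᵥ x) = theta n x := by
  unfold theta
  congr 1
  · refine Finset.sum_congr rfl fun i _ => ?_
    rw [sigmaMat, Matrix.fromBlocks_mulVec]
    simp only [Sum.elim_inl, Matrix.zero_mulVec, add_zero, Matrix.fromBlocks_mulVec,
      Sum.elim_inr, Pi.add_apply, Matrix.mulVec_diagonal, Function.comp_apply]
    split_ifs <;> ring
  · rw [sigmaMat, Matrix.fromBlocks_mulVec]
    simp

/-- `σ_r` as an element of `O(2n+1, q)`. -/
def sigma (n r : ℕ) (F : Type*) [Field F] : O n F :=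
  ⟨⟨sigmaMat n r F, sigmaMat n r F, sigmaMat_mul_self n r F, sigmaMat_mul_self n r F⟩,
    theta_sigmaMat n r⟩

/-- The double coset `DC(n, q) = P σ_{n-1} P` in `O(2n+1, q)`. -/
def DC (n : ℕ) (F : Type*) [Field F] : Set (O n F) :=
  DoubleCoset.doubleCoset (sigma n (n - 1) F) (P n F) (P n F)

/-- The absolute trace `tr : 𝔽_q → 𝔽₂`. -/
noncomputable def tr {F : Type*} [Field F] [Algebra (ZMod 2) F] (x : F) : ZMod 2 :=
  Algebra.trace (ZMod 2) F x

/-- For `q = 2^r`, `tr x = x + x² + ⋯ + x^{2^{r-1}}`. -/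
theorem tr_eq_sum {F : Type*} [Field F] [Fintype F] [Algebra (ZMod 2) F] (r : ℕ)
    (hr : Fintype.card F = 2 ^ r) (x : F) :
    algebraMap (ZMod 2) F (tr x) = ∑ i ∈ Finset.range r, x ^ 2 ^ i := by
  have h1 : Module.finrank (ZMod 2) F = r := by
    have h := Module.card_eq_pow_finrank (K := ZMod 2) (V := F)
    rw [hr, ZMod.card] at h
    exact (Nat.pow_right_injective le_rfl h).symm
  have h2 := FiniteField.algebraMap_trace_eq_sum_pow (ZMod 2) F x
  rw [h1, Nat.card_zmod] at h2
  exact h2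

/-- The canonical additive character `λ(x) = (-1)^{tr x}` of `𝔽_q`. -/
noncomputable def lam (F : Type*) [Field F] [Algebra (ZMod 2) F] : AddChar F ℂ where
  toFun x := (-1) ^ (tr x).val
  map_zero_eq_one' := by simp [tr]
  map_add_eq_mul' x y := by
    have h : ∀ s t : ZMod 2, ((-1 : ℂ)) ^ (s + t).val = (-1) ^ s.val * (-1) ^ t.val := by
      intro s t
      rw [ZMod.val_add, ← pow_add, neg_one_pow_eq_pow_mod_two (n := s.val + t.val)]
    simp only [tr, map_add]
    exact h _ _

/-- The Kloosterman sum `K(ψ; a) = ∑_{α ∈ 𝔽_q^*} ψ(α + a α⁻¹)`. -/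
noncomputable def kloosterman {F : Type*} [Field F] [Fintype F] [DecidableEq F]
    (ψ : AddChar F ℂ) (a : Fˣ) : ℂ :=
  ∑ α : Fˣ, ψ ((α : F) + (a : F) * (α : F)⁻¹)

/-- The `q`-binomial coefficient `∏_{j=0}^{r-1} (q^{n-j} - 1)/(q^{r-j} - 1)`, for `r ≤ n`. -/
def qBinom (n r q : ℕ) : ℚ :=
  ∏ j ∈ Finset.range r, ((q : ℚ) ^ (n - j) - 1) / ((q : ℚ) ^ (r - j) - 1)

/-- `A(n, q) = q^{(5n²-1)/4} [n choose 1]_q ∏_{j=1}^{(n-1)/2} (q^{2j-1} - 1)`; it is used for odd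
`n ≥ 1`, where the divisions of natural numbers are exact. -/
def A (n q : ℕ) : ℚ :=
  (q : ℚ) ^ ((5 * n ^ 2 - 1) / 4) * qBinom n 1 q *
    ∏ j ∈ Finset.Icc 1 ((n - 1) / 2), ((q : ℚ) ^ (2 * j - 1) - 1)

/-- `B(n, q) = q^{(n-1)²/4} (q^n - 1) ∏_{j=1}^{(n-1)/2} (q^{2j} - 1)`; it is used for odd
`n ≥ 1`, where the divisions of natural numbers are exact. -/
def B (n q : ℕ) : ℚ :=
  (q : ℚ) ^ ((n - 1) ^ 2 / 4) * ((q : ℚ) ^ n - 1) *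
    ∏ j ∈ Finset.Icc 1 ((n - 1) / 2), ((q : ℚ) ^ (2 * j) - 1)

/-- The length `N(n, q) = |DC(n, q)|` of the code. -/
noncomputable def N (n : ℕ) (F : Type*) [Field F] : ℕ := Nat.card (DC n F)

/-- The vector `v(n, q) = (Tr g₁, …, Tr g_N)`, for an ordering `g` of the elements of `DC(n, q)`. -/
noncomputable def v {n : ℕ} {F : Type*} [Field F] (g : Fin (N n F) ≃ DC n F) :
    Fin (N n F) → F :=
  fun i => (toMat (g i : O n F)).trace

/-- The binary linear code `C(DC(n, q)) = {u ∈ 𝔽₂^N | u · v(n, q) = 0}`. -/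
noncomputable def code {n : ℕ} {F : Type*} [Field F] [Algebra (ZMod 2) F]
    (g : Fin (N n F) ≃ DC n F) : Submodule (ZMod 2) (Fin (N n F) → ZMod 2) where
  carrier := {u | ∑ i, u i • v g i = 0}
  zero_mem' := by simp
  add_mem' := by
    intro a b ha hb
    simp only [Set.mem_ofPred_eq] at ha hb ⊢
    simp [add_smul, Finset.sum_add_distrib, ha, hb]
  smul_mem' := by
    intro c a ha
    simp only [Set.mem_ofPred_eq] at ha ⊢
    simp only [Pi.smul_apply, smul_assoc, ← Finset.smul_sum, ha, smul_zero]

/-- The dual code `C^⊥ = {c ∈ 𝔽₂^N | u · c = 0 for all u ∈ C}`. -/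
def dual {m : ℕ} (C : Submodule (ZMod 2) (Fin m → ZMod 2)) :
    Submodule (ZMod 2) (Fin m → ZMod 2) where
  carrier := {c | ∀ u ∈ C, u ⬝ᵥ c = 0}
  zero_mem' := by simp
  add_mem' := by
    intro a b ha hb u hu
    rw [dotProduct_add, ha u hu, hb u hu, add_zero]
  smul_mem' := by
    intro c a ha u hu
    rw [dotProduct_smul, ha u hu, smul_zero]

/-- The word `c(a) = (tr(a Tr g₁), …, tr(a Tr g_N))`. -/
noncomputable def codeword {n : ℕ} {F : Type*} [Field F] [Algebra (ZMod 2) F]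
    (g : Fin (N n F) ≃ DC n F) (a : F) : Fin (N n F) → ZMod 2 :=
  fun i => tr (a * v g i)

end OddOrthogonalCode

/-! Since `λ` is 1 where `tr` vanishes and -1 elsewhere, the weight of `c(a)` is half the difference
between `|DC|` and the sum of `λ(a Tr w)` over `w ∈ DC`; membership in the dual is just
`𝔽₂`-linearity of `tr`. What remains is to compute these two quantities.

Both come from one identity. For a class function `f` and `σ = σ_{n-1}`, each element of `PσP` is
written `xσy` in `|P ∩ σPσ⁻¹|` ways, and `f(xσy) = f(yxσ)`, so `|P ∩ σPσ⁻¹| ∑_{w ∈ DC} f(w) = |P|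
∑_{x ∈ P} f(xσ)` (`card_mul_sum_doubleCoset`). Taking `f = 1` gives the length; taking `f = λ(a Tr
·)` gives the character sum.

In characteristic two `h` is determined by the diagonal of the symmetric matrix `B`, so `P` is
parametrised by pairs `(A, B)` with `A` invertible and `B` symmetric. With `m = n - 1`, the trace of
`xσ` is `1 + A_nn + (A⁻¹)_nn + ∑_{i ≤ m} (AB)_ii`. By orthogonality of characters the sum over `B`
vanishes unless `A` has the form `[A₁ 0; c d]` with `A₁` alternating (`sum_lam_partialTrace`). Then
`A₁` runs over the nonsingular alternating matrices of size `m`, `c` is free, and the sum over `d`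
of `λ(a(1 + d + d⁻¹))` equals `λ(a)K(λ;a)` (`sum_lam_add_inv`).

Finally the nonsingular alternating matrices of even size are counted (`card_altGL_two_mul`).
Together with the order of `GL`, this identifies the constants as `A(n,q)` and `B(n,q)`, with `|DC|
= A(n,q)B(n,q)`. Oddness of `n` makes `m` even. -/

namespace OddOrthogonalCode

/-! ### Class functions summed over a double coset. -/

open Classical in
/-- Summing a class function over a double coset `H s H` of a finite group. -/
theorem card_mul_sum_doubleCoset {G : Type*} [Group G] [Fintype G] (H : Subgroup G) (s : G)
    (f : G → ℂ) (hf : ∀ x y, f (x * y) = f (y * x)) :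
    ((Finset.univ.filter fun b : G => b ∈ H ∧ s⁻¹ * b * s ∈ H).card : ℂ) *
        ∑ w ∈ Finset.univ.filter (· ∈ DoubleCoset.doubleCoset s (H : Set G) (H : Set G)), f w =
      ((Finset.univ.filter (· ∈ H)).card : ℂ) *
        ∑ x ∈ Finset.univ.filter (· ∈ H), f (x * s) := by
  set S : Finset G := Finset.univ.filter (· ∈ H) with hS
  have hmem : ∀ x, x ∈ S ↔ x ∈ H := fun x => by simp [hS]
  have h1 : ∑ p ∈ S ×ˢ S, f (p.1 * s * p.2) = (S.card : ℂ) * ∑ x ∈ S, f (x * s) := by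
    rw [Finset.sum_product_right, ← nsmul_eq_mul, ← Finset.sum_const]
    refine Finset.sum_congr rfl fun y hy => ?_
    -- For fixed `y`, conjugation invariance moves `y` to the front, and `y * x` runs over `H` as
    -- `x` does.
    refine Finset.sum_bij (fun x _ => y * x) ?_ ?_ ?_ ?_
    · intro x hx
      exact (hmem _).2 (H.mul_mem ((hmem _).1 hy) ((hmem _).1 hx))
    · intro x _ x' _ h
      exact mul_left_cancel h
    · intro z hz
      exact ⟨y⁻¹ * z, (hmem _).2 (H.mul_mem (H.inv_mem ((hmem _).1 hy)) ((hmem _).1 hz)), by group⟩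
    · intro x _
      rw [hf, mul_assoc]
  rw [← h1, Finset.mul_sum]
  rw [← Finset.sum_fiberwise_of_maps_to (s := S ×ˢ S)
    (t := Finset.univ.filter (· ∈ DoubleCoset.doubleCoset s (H : Set G) (H : Set G)))
    (g := fun p => p.1 * s * p.2)]
  · refine Finset.sum_congr rfl fun w hw => ?_
    obtain ⟨p, hp, r, hr, rfl⟩ := DoubleCoset.mem_doubleCoset.1 (Finset.mem_filter.1 hw).2
    rw [Finset.sum_congr rfl (g := fun _ => f (p * s * r)), Finset.sum_const, nsmul_eq_mul]
    · congr 2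
      -- The factorisations `x * s * y` of `p * s * r` form a torsor under `H ∩ s H s⁻¹`.
      refine Finset.card_bij (fun b _ => (p * b, s⁻¹ * b⁻¹ * s * r)) ?_ ?_ ?_
      · intro b hb
        simp only [Finset.mem_filter, Finset.mem_univ, true_and] at hb
        simp only [Finset.mem_filter, Finset.mem_product, hmem]
        refine ⟨⟨H.mul_mem hp hb.1, H.mul_mem ?_ hr⟩, by group⟩
        simpa [mul_assoc] using H.inv_mem hb.2
      · intro b _ b' _ h
        exact mul_left_cancel (Prod.ext_iff.1 h).1
      · rintro ⟨x, y⟩ h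
        simp only [Finset.mem_filter, Finset.mem_product, hmem] at h
        have hy : y = s⁻¹ * x⁻¹ * (p * s * r) := by rw [← h.2]; group
        refine ⟨p⁻¹ * x, ?_, ?_⟩
        · simp only [Finset.mem_filter, Finset.mem_univ, true_and]
          refine ⟨H.mul_mem (H.inv_mem hp) h.1.1, ?_⟩
          have : s⁻¹ * (p⁻¹ * x) * s = r * y⁻¹ := by rw [hy]; group
          rw [this]
          exact H.mul_mem hr (H.inv_mem h.1.2)
        · rw [hy]; ext <;> simp [mul_assoc]
    · intro x hx
      rw [(Finset.mem_filter.1 hx).2]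
  · rintro ⟨x, y⟩ h
    simp only [Finset.mem_product, hmem] at h
    simp only [Finset.mem_filter, Finset.mem_univ, true_and]
    exact DoubleCoset.mem_doubleCoset.2 ⟨x, h.1, y, h.2, rfl⟩

/-! ### Counting nonsingular alternating matrices. -/

section Alternating

variable {F : Type*} [Field F]

/-- An antisymmetric function on pairs, vanishing on the diagonal, sums to zero. -/
theorem sum_sum_eq_zero_of_antisymm {ι : Type*} [Fintype ι] (f : ι → ι → F)
    (h0 : ∀ i, f i i = 0) (h1 : ∀ i j, f i j + f j i = 0) : ∑ i, ∑ j, f i j = 0 := by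
  rw [← Finset.sum_product']
  -- The diagonal needs its own hypothesis, since in characteristic two `f i i + f i i = 0` says
  -- nothing.
  refine Finset.sum_involution (fun p _ => (p.2, p.1)) ?_ ?_ ?_ ?_
  · intro p _
    exact h1 _ _
  · rintro ⟨i, j⟩ _ h h'
    obtain rfl : j = i := (Prod.ext_iff.1 h').1
    exact h (h0 _)
  · intro p _
    simp
  · intro p _
    rfl

theorem IsAlternating.dotProduct_mulVec {n : ℕ} {X : Matrix (Fin n) (Fin n) F}
    (hX : IsAlternating X) (v : Fin n → F) : v ⬝ᵥ X *ᵥ v = 0 := by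
  simp only [dotProduct, Matrix.mulVec, Finset.mul_sum]
  refine sum_sum_eq_zero_of_antisymm _ (fun i => by simp [hX.1]) fun i j => ?_
  rw [hX.2 i j]
  ring

/-- Evaluating at `e_i` gives the diagonal, and at `e_i + e_j` the skew-symmetry. In this form
invariance under congruence is a substitution, valid in every characteristic. -/
theorem isAlternating_iff {n : ℕ} {X : Matrix (Fin n) (Fin n) F} :
    IsAlternating X ↔ ∀ v, v ⬝ᵥ X *ᵥ v = 0 := by
  refine ⟨fun h => h.dotProduct_mulVec, fun h => ?_⟩
  have h0 : ∀ i, X i i = 0 := fun i => by simpa using h (Pi.single i 1)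
  refine ⟨h0, fun i j => ?_⟩
  have := h (Pi.single i 1 + Pi.single j 1)
  simp [Matrix.mulVec_add, h0] at this
  linear_combination this

theorem IsAlternating.congr {n : ℕ} {X : Matrix (Fin n) (Fin n) F} (hX : IsAlternating X)
    (K : Matrix (Fin n) (Fin n) F) : IsAlternating (K * X * Kᵀ) := by
  rw [isAlternating_iff] at hX ⊢
  intro v
  have := hX (Kᵀ *ᵥ v)
  rwa [Matrix.mulVec_mulVec, Matrix.mulVec_transpose, ← Matrix.dotProduct_mulVec,
    Matrix.mulVec_mulVec, ← mul_assoc] at this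

/-- The nonsingular alternating matrices of size `m`. -/
abbrev AltGL (F : Type*) [Field F] (m : ℕ) : Type _ :=
  {X : Matrix (Fin m) (Fin m) F // IsAlternating X ∧ X.det ≠ 0}

/-- Congruence by an invertible matrix, as a permutation of the nonsingular alternating matrices. -/
noncomputable def AltGL.congr {m : ℕ} (K : Matrix (Fin m) (Fin m) F) (hK : IsUnit K.det) :
    AltGL F m ≃ AltGL F m where
  toFun X := ⟨K * X.1 * Kᵀ, X.2.1.congr K, by
    simpa [Matrix.det_mul, X.2.2] using hK.ne_zero⟩
  invFun X := ⟨K⁻¹ * X.1 * (K⁻¹)ᵀ, X.2.1.congr K⁻¹, by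
    simpa [Matrix.det_mul, X.2.2, Matrix.det_nonsing_inv] using hK.ne_zero⟩
  left_inv X := by
    ext1
    change K⁻¹ * (K * X.1 * Kᵀ) * (K⁻¹)ᵀ = X.1
    rw [mul_assoc K, Matrix.nonsing_inv_mul_cancel_left _ _ hK, mul_assoc, ← Matrix.transpose_mul,
      Matrix.nonsing_inv_mul _ hK, Matrix.transpose_one, mul_one]
  right_inv X := by
    ext1
    change K * (K⁻¹ * X.1 * (K⁻¹)ᵀ) * Kᵀ = X.1
    rw [mul_assoc K⁻¹, Matrix.mul_nonsing_inv_cancel_left _ _ hK, mul_assoc,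
      ← Matrix.transpose_mul, Matrix.mul_nonsing_inv _ hK, Matrix.transpose_one, mul_one]

/-- A vector `x ≠ 0` with `x 0 = 0` is the second column of an invertible matrix whose first row
is that of the identity matrix. -/
theorem exists_isUnit_det_col_one {m : ℕ} (x : Fin (m + 2) → F) (h0 : x 0 = 0) (hx : x ≠ 0) :
    ∃ K : Matrix (Fin (m + 2)) (Fin (m + 2)) F, IsUnit K.det ∧ K 0 = Pi.single 0 1 ∧
      K *ᵥ Pi.single 1 1 = x := by
  obtain ⟨i, hi⟩ := Function.ne_iff.1 hx
  have hi0 : i ≠ 0 := by rintro rfl; exact hi h0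
  -- Column `i` of the identity, where `x i ≠ 0`, is replaced by `x` and then swapped with column
  -- `1`. The determinant is `± x i`, and row `0` is unaffected because `x 0 = 0` and `i ≠ 0`.
  refine ⟨((1 : Matrix (Fin (m + 2)) (Fin (m + 2)) F).updateCol i x).submatrix id
    (Equiv.swap 1 i), ?_, ?_, ?_⟩
  · rw [Matrix.det_permute', ← Matrix.cramer_apply, Matrix.cramer_one]
    simp only [isUnit_iff_ne_zero, mul_ne_zero_iff]
    refine ⟨?_, hi⟩
    rcases Int.units_eq_one_or (Equiv.Perm.sign (Equiv.swap 1 i)) with h | h <;> simp [h]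
  · funext j
    rw [Matrix.submatrix_apply, Matrix.updateCol_apply]
    by_cases hj : Equiv.swap 1 i j = i
    · have : j = 1 := by
        rw [← Equiv.swap_apply_left (1 : Fin (m + 2)) i] at hj
        exact (Equiv.swap 1 i).injective hj
      subst this
      simp [h0]
    · rw [if_neg hj, id]
      have h00 : Equiv.swap 1 i 0 = 0 := Equiv.swap_apply_of_ne_of_ne (by simp) hi0.symm
      by_cases hj0 : j = 0
      · subst hj0; rw [h00]; simp
      · rw [Pi.single_eq_of_ne hj0, Matrix.one_apply_ne]
        intro h
        apply hj0
        apply (Equiv.swap 1 i).injective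
        rw [← h, h00]
  · funext j
    simp

/-- The alternating matrix with first row `(0, 1, 0, …, 0)` and second row `(-1, 0, y)`, bordering
`Z`. -/
def altBorder {m : ℕ} (y : Fin m → F) (Z : Matrix (Fin m) (Fin m) F) :
    Matrix (Fin (m + 2)) (Fin (m + 2)) F :=
  Matrix.of (Fin.cons (Fin.cons 0 (Fin.cons 1 0)) (Fin.cons (Fin.cons (-1) (Fin.cons 0 y))
    fun i => Fin.cons 0 (Fin.cons (-y i) (Z i))))

/-- Expansion along the first row leaves only the entry `1`, and then along the first column only
`-1`; with the cofactor sign the product is `1`. -/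
theorem det_altBorder {m : ℕ} (y : Fin m → F) (Z : Matrix (Fin m) (Fin m) F) :
    (altBorder y Z).det = Z.det := by
  rw [Matrix.det_succ_row_zero, Fin.sum_univ_succ, Fin.sum_univ_succ, Matrix.det_succ_column_zero,
    Fin.sum_univ_succ]
  rw [Matrix.det_succ_column_zero ((altBorder y Z).submatrix _ (Fin.succAbove (Fin.succ 0))),
    Fin.sum_univ_succ]
  have : ((altBorder y Z).submatrix Fin.succ (Fin.succAbove (Fin.succ 0))).submatrix
      (Fin.succAbove 0) Fin.succ = Z := by
    ext i j
    simp [altBorder, Fin.succAbove]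
  rw [this]
  simp [altBorder]

theorem isAlternating_altBorder {m : ℕ} {y : Fin m → F} {Z : Matrix (Fin m) (Fin m) F} :
    IsAlternating (altBorder y Z) ↔ IsAlternating Z := by
  constructor
  · intro h
    exact ⟨fun i => h.1 i.succ.succ, fun i j => h.2 i.succ.succ j.succ.succ⟩
  · intro h
    constructor
    · intro i
      refine Fin.cases ?_ (fun i => Fin.cases ?_ (fun i => ?_) i) i
      · simp [altBorder]
      · simp [altBorder]
      · simpa [altBorder] using h.1 i
    · intro i j
      refine Fin.cases ?_ (fun i => Fin.cases ?_ (fun i => ?_) i) i <;>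
      refine Fin.cases ?_ (fun j => Fin.cases ?_ (fun j => ?_) j) j
      all_goals simp [altBorder]
      exact h.2 i j

/-- Nonsingular alternating matrices with first row `(0, 1, 0, …, 0)`. -/
noncomputable def altBorderEquiv (F : Type*) [Field F] (m : ℕ) :
    (Fin m → F) × AltGL F m ≃ {X : AltGL F (m + 2) // X.1 0 = Pi.single 1 1} :=
  Equiv.ofBijective
    (fun p => ⟨⟨altBorder p.1 p.2.1, isAlternating_altBorder.2 p.2.2.1, by
      rw [det_altBorder]; exact p.2.2.2⟩, by
        funext j
        refine Fin.cases ?_ (fun j => Fin.cases ?_ (fun j => ?_) j) j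
        · simp [altBorder]
        · simp [altBorder]
        · simp only [altBorder, Matrix.of_apply, Fin.cons_zero, Fin.cons_succ]
          rw [Pi.single_eq_of_ne]
          · rfl
          · intro h
            have := congrArg Fin.val h
            simp at this⟩) (by
    constructor
    · rintro ⟨y, Z, hZ⟩ ⟨y', Z', hZ'⟩ h
      have h' : altBorder y Z = altBorder y' Z' := congrArg (fun X => X.1.1) h
      ext i j
      · exact congrFun (congrFun h' 1) i.succ.succ
      · exact congrFun (congrFun h' i.succ.succ) j.succ.succ
    · rintro ⟨⟨X, hX, hd⟩, hX0⟩
      have key : altBorder (fun i => X 1 i.succ.succ)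
          (Matrix.of fun i j => X i.succ.succ j.succ.succ) = X := by
        ext i j
        have h0 : ∀ j, X 0 j = (Pi.single 1 1 : Fin (m + 2) → F) j := fun j => congrFun hX0 j
        have hs : ∀ i : Fin m, (i.succ.succ : Fin (m + 2)) ≠ 1 := fun i h => by
          have := congrArg Fin.val h
          simp at this
        refine Fin.cases ?_ (fun i => Fin.cases ?_ (fun i => ?_) i) i <;>
        refine Fin.cases ?_ (fun j => Fin.cases ?_ (fun j => ?_) j) j
        · simp [altBorder, h0]
        · simp [altBorder, h0]
        · simp [altBorder, h0, hs]
        · rw [hX.2, h0]; simp [altBorder]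
        · have := hX.1 1
          simpa [altBorder] using this.symm
        · simp [altBorder]
        · rw [hX.2, h0]; simp [altBorder, hs]
        · rw [hX.2 i.succ.succ]; simp [altBorder]
        · simp [altBorder]
      refine ⟨⟨fun i => X 1 i.succ.succ, ⟨Matrix.of fun i j => X i.succ.succ j.succ.succ, ?_, ?_⟩⟩,
        ?_⟩
      · rw [← isAlternating_altBorder, key]; exact hX
      · rw [← det_altBorder, key]; exact hd
      · ext1; ext1; exact key)

/-- Matrices are sorted by their first row, a nonzero vector with zero first entry. Congruence by
`K` with first row `e_0` and `K e_1 = x` carries the matrices with first row `e_1` onto those with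
first row `x`. All fibres therefore have the size given by `altBorderEquiv`. -/
theorem card_altGL_add_two [Fintype F] (m : ℕ) :
    Nat.card (AltGL F (m + 2)) =
      (Fintype.card F ^ (m + 1) - 1) * (Fintype.card F ^ m * Nat.card (AltGL F m)) := by
  classical
  let β := {x : Fin (m + 2) → F // x 0 = 0 ∧ x ≠ 0}
  let row : AltGL F (m + 2) → β := fun X => ⟨X.1 0, X.2.1.1 0, fun h =>
    X.2.2 (Matrix.det_eq_zero_of_row_eq_zero 0 fun j => congrFun h j)⟩
  have hβ : Nat.card β = Fintype.card F ^ (m + 1) - 1 := by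
    have e : {x : Fin (m + 1) → F // x ≠ 0} ≃ β :=
      { toFun x := ⟨Fin.cons 0 x.1, rfl, fun h => x.2 (by
          funext j; simpa using congrFun h j.succ)⟩
        invFun x := ⟨Fin.tail x.1, fun h => x.2.2 (by
          funext j
          refine Fin.cases x.2.1 (fun j => congrFun h j) j)⟩
        left_inv x := by ext1; simp
        right_inv x := by
          ext1
          change Fin.cons 0 (Fin.tail x.1) = x.1
          conv_rhs => rw [← Fin.cons_self_tail x.1, x.2.1] }
    rw [← Nat.card_congr e, Nat.card_eq_fintype_card, Fintype.card_subtype_compl,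
      Fintype.card_subtype_eq]
    simp
  have hfib : ∀ x : β, Nat.card {X // row X = x} =
      Fintype.card F ^ m * Nat.card (AltGL F m) := by
    intro x
    obtain ⟨K, hK, hK0, hK1⟩ := exists_isUnit_det_col_one x.1 x.2.1 x.2.2
    have e : {X : AltGL F (m + 2) // X.1 0 = Pi.single 1 1} ≃ {X // row X = x} := by
      refine Equiv.subtypeEquiv (AltGL.congr K hK) fun Y => ?_
      have h2 : (K * Y.1 * Kᵀ) 0 = K *ᵥ (Y.1 0) := by
        have : (K * Y.1) 0 = Y.1 0 := by
          funext j
          rw [Matrix.mul_apply, hK0, Finset.sum_eq_single 0] <;> simp +contextual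
        funext j
        rw [Matrix.mul_apply, this]
        simp [Matrix.mulVec, dotProduct, mul_comm]
      rw [Subtype.ext_iff]
      change _ ↔ (K * Y.1 * Kᵀ) 0 = x.1
      rw [h2, ← hK1]
      exact (Matrix.mulVec_injective_iff_isUnit.2
        ((Matrix.isUnit_iff_isUnit_det K).2 hK)).eq_iff.symm
    rw [← Nat.card_congr e, ← Nat.card_congr (altBorderEquiv F m), Nat.card_prod]
    simp
  rw [← Nat.card_congr (Equiv.sigmaFiberEquiv row), Nat.card_sigma]
  simp only [hfib, Finset.sum_const, smul_eq_mul, Finset.card_univ]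
  rw [← hβ, Nat.card_eq_fintype_card (α := β)]

theorem card_altGL_two_mul [Fintype F] (k : ℕ) :
    (Nat.card (AltGL F (2 * k)) : ℚ) = (Fintype.card F : ℚ) ^ (k * (k - 1)) *
      ∏ j ∈ Finset.Icc 1 k, ((Fintype.card F : ℚ) ^ (2 * j - 1) - 1) := by
  induction k with
  | zero =>
    have : Nat.card (AltGL F 0) = 1 := by
      rw [Nat.card_eq_one_iff_unique]
      exact ⟨inferInstance, ⟨⟨0, ⟨fun i => i.elim0, fun i => i.elim0⟩, by simp⟩⟩⟩
    simpa using this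
  | succ k ih =>
    rw [show 2 * (k + 1) = 2 * k + 2 by ring, card_altGL_add_two, Finset.prod_Icc_succ_top (by omega)]
    push_cast [Nat.one_le_pow _ _ (Fintype.card_pos (α := F))]
    rw [ih, show 2 * (k + 1) - 1 = 2 * k + 1 by omega]
    have : (k + 1) * k = 2 * k + k * (k - 1) := by
      cases k with
      | zero => rfl
      | succ j => rw [Nat.add_sub_cancel]; ring
    rw [this, pow_add]
    ring

end Alternating

/-! ### Parametrising the parabolic subgroup by an invertible and a symmetric matrix. -/

section Parabolic

variable {F : Type*} [Field F]

theorem levi_mul_unip {n : ℕ} (A : GL (Fin n) F) (B : Matrix (Fin n) (Fin n) F)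
    (h : Matrix (Fin 1) (Fin n) F) :
    levi A * unip B h = Matrix.fromBlocks
      (Matrix.fromBlocks (A : Matrix (Fin n) (Fin n) F) ((A : Matrix (Fin n) (Fin n) F) * B) 0
        ((A⁻¹ : GL (Fin n) F) : Matrix (Fin n) (Fin n) F)ᵀ)
      0 (Matrix.fromCols 0 h) 1 := by
  simp [levi, unip, Matrix.fromBlocks_multiply]

theorem det_levi_mul_unip {n : ℕ} (A : GL (Fin n) F) (B : Matrix (Fin n) (Fin n) F)
    (h : Matrix (Fin 1) (Fin n) F) : (levi A * unip B h).det = 1 := by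
  rw [levi_mul_unip, Matrix.det_fromBlocks_zero₁₂, Matrix.det_fromBlocks_zero₂₁,
    Matrix.det_transpose, ← Matrix.det_mul, ← Units.val_mul]
  simp

/-- The symmetric matrices. -/
def Sym (n : ℕ) (F : Type*) [Field F] : AddSubgroup (Matrix (Fin n) (Fin n) F) where
  carrier := {B | B.IsSymm}
  zero_mem' := Matrix.isSymm_zero
  add_mem' := fun ha hb => ha.add hb
  neg_mem' := fun ha => ha.neg

theorem Sym.apply_comm {n : ℕ} (B : Sym n F) (i j : Fin n) : B.1 i j = B.1 j i :=
  Matrix.IsSymm.apply B.2 j i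

theorem card_sym (n : ℕ) (F : Type*) [Field F] [Fintype F] :
    Nat.card (Sym n F) = Fintype.card F ^ ((n + 1).choose 2) := by
  classical
  have e : Sym n F ≃ {f : Fin n → Fin n → F // ∀ a b, f a b = f b a} :=
    Equiv.subtypeEquivRight fun B => ⟨fun h a b => Matrix.IsSymm.apply h b a,
      fun h => Matrix.IsSymm.ext fun a b => h b a⟩
  rw [Nat.card_congr (e.trans Sym2.lift), Nat.card_eq_fintype_card, Fintype.card_fun, Sym2.card,
    Fintype.card_fin]

/-- The polar form of `theta` in characteristic two. -/
def polar (n : ℕ) (x y : Idx n → F) : F :=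
  ∑ i : Fin n, (x (Sum.inl (Sum.inl i)) * y (Sum.inl (Sum.inr i)) +
    x (Sum.inl (Sum.inr i)) * y (Sum.inl (Sum.inl i)))

theorem toMat_mul {n : ℕ} (w w' : O n F) : toMat (w * w') = toMat w * toMat w' := rfl

variable [CharP F 2]

theorem theta_add (n : ℕ) (x y : Idx n → F) :
    theta n (x + y) = theta n x + theta n y + polar n x y := by
  simp only [theta, polar, Pi.add_apply, CharTwo.add_sq]
  rw [add_add_add_comm, add_right_comm, ← Finset.sum_add_distrib, ← Finset.sum_add_distrib]
  congr 1
  refine Finset.sum_congr rfl fun i _ => ?_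
  ring

theorem polar_mulVec {n : ℕ} (w : O n F) (x y : Idx n → F) :
    polar n (toMat w *ᵥ x) (toMat w *ᵥ y) = polar n x y := by
  have h := theta_add n (toMat w *ᵥ x) (toMat w *ᵥ y)
  rw [← Matrix.mulVec_add, toMat, w.2, w.2, w.2, theta_add] at h
  exact (add_left_cancel h).symm

/-- Signs disappear in characteristic two. As squaring is bijective on a finite such field, `h`
carries no information beyond `B`, and `B` may be any symmetric matrix. -/
theorem isAlternating_add_iff {n : ℕ} {B : Matrix (Fin n) (Fin n) F}
    {h : Matrix (Fin 1) (Fin n) F} :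
    IsAlternating (B + hᵀ * h) ↔ B.IsSymm ∧ ∀ k, B k k = h 0 k ^ 2 := by
  have key : ∀ i j, (B + hᵀ * h) i j = B i j + h 0 i * h 0 j := fun i j => by
    simp [Matrix.mul_apply]
  simp only [IsAlternating, key, CharTwo.neg_eq, CharTwo.add_eq_zero]
  constructor
  · rintro ⟨h0, h1⟩
    refine ⟨Matrix.IsSymm.ext fun i j => ?_, fun k => by rw [h0, sq]⟩
    have := h1 i j
    rw [mul_comm] at this
    exact (add_right_cancel this).symm
  · rintro ⟨h0, h1⟩
    exact ⟨fun i => by rw [h1, sq], fun i j => by rw [h0.apply j i, mul_comm]⟩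

/-- On `x = (u, v, z)` the form changes by `v ⬝ᵥ B *ᵥ v + (h *ᵥ v)²`, which is the value at `v` of
the quadratic form of `B + hᵀ * h`. The Levi factor preserves the pairing of the two blocks. -/
theorem theta_levi_mul_unip {n : ℕ} (A : GL (Fin n) F) {B : Matrix (Fin n) (Fin n) F}
    {h : Matrix (Fin 1) (Fin n) F} (hB : IsAlternating (B + hᵀ * h)) (x : Idx n → F) :
    theta n ((levi A * unip B h) *ᵥ x) = theta n x := by
  obtain ⟨u, v, z, rfl⟩ : ∃ (u v : Fin n → F) (z : Fin 1 → F), x = Sum.elim (Sum.elim u v) z :=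
    ⟨_, _, _, by funext i; rcases i with (i | i) | i <;> rfl⟩
  have h0 := hB.dotProduct_mulVec v
  have hh : v ⬝ᵥ (hᵀ * h) *ᵥ v = (h *ᵥ v) 0 ^ 2 := by
    rw [← Matrix.mulVec_mulVec, Matrix.dotProduct_mulVec, Matrix.vecMul_transpose]
    simp [dotProduct, sq]
  rw [Matrix.add_mulVec, dotProduct_add, hh] at h0
  have hA : ∀ y : Fin n → F, ((A : Matrix (Fin n) (Fin n) F) *ᵥ y) ⬝ᵥ
      (((A⁻¹ : GL (Fin n) F) : Matrix (Fin n) (Fin n) F)ᵀ *ᵥ v) = y ⬝ᵥ v := by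
    intro y
    rw [Matrix.mulVec_transpose, dotProduct_comm, ← Matrix.dotProduct_mulVec,
      Matrix.mulVec_mulVec, ← Units.val_mul]
    simp [dotProduct_comm]
  have e : ∀ (u v : Fin n → F) (z : Fin 1 → F),
      theta n (Sum.elim (Sum.elim u v) z) = u ⬝ᵥ v + z 0 ^ 2 := fun u v z => rfl
  rw [levi_mul_unip, Matrix.fromBlocks_mulVec]
  simp only [Sum.elim_comp_inl, Sum.elim_comp_inr, Matrix.fromBlocks_mulVec,
    Matrix.zero_mulVec, add_zero, zero_add, Matrix.fromCols_mulVec, Matrix.one_mulVec]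
  rw [e, e, ← Matrix.mulVec_mulVec, ← Matrix.mulVec_add, hA, add_dotProduct, Pi.add_apply,
    CharTwo.add_sq, dotProduct_comm (B *ᵥ v)]
  linear_combination h0

/-- Membership in the parabolic subgroup: the span of the first `n` coordinates is preserved. -/
theorem mem_P_iff {n : ℕ} {w : O n F} : w ∈ P n F ↔
    (∀ i j, toMat w (Sum.inl (Sum.inr i)) (Sum.inl (Sum.inl j)) = 0) ∧
      ∀ j, toMat w (Sum.inr 0) (Sum.inl (Sum.inl j)) = 0 := by
  constructor
  · rintro ⟨A, B, h, -, hw⟩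
    rw [hw, levi_mul_unip]
    exact ⟨fun i j => rfl, fun j => rfl⟩
  · rintro ⟨h1, h2⟩
    set M := toMat w with hM
    -- An isometry preserves both the polar form and `theta` on basis vectors; all the block
    -- relations below are read off from the columns of `M`.
    have hp : ∀ x y : Idx n, polar n (fun i => M i x) (fun i => M i y) =
        polar n (Pi.single x 1) (Pi.single y 1) := fun x y => by
      rw [← polar_mulVec w (Pi.single x 1), Matrix.mulVec_single_one, Matrix.mulVec_single_one]
      rfl
    have ht : ∀ x : Idx n, theta n (fun i => M i x) = theta n (Pi.single x 1) := fun x => by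
      rw [← w.2 (Pi.single x 1)]
      change _ = theta n (M *ᵥ _)
      rw [Matrix.mulVec_single_one]
      rfl
    let A : Matrix (Fin n) (Fin n) F := Matrix.of fun i j => M (Sum.inl (Sum.inl i)) (Sum.inl (Sum.inl j))
    let X : Matrix (Fin n) (Fin n) F := Matrix.of fun i j => M (Sum.inl (Sum.inl i)) (Sum.inl (Sum.inr j))
    let D : Matrix (Fin n) (Fin n) F := Matrix.of fun i j => M (Sum.inl (Sum.inr i)) (Sum.inl (Sum.inr j))
    let e : Fin n → F := fun i => M (Sum.inl (Sum.inl i)) (Sum.inr 0)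
    let f : Fin n → F := fun i => M (Sum.inl (Sum.inr i)) (Sum.inr 0)
    let h : Matrix (Fin 1) (Fin n) F := Matrix.of fun _ j => M (Sum.inr 0) (Sum.inl (Sum.inr j))
    have hAD : Aᵀ * D = 1 := by
      ext i j
      have := hp (Sum.inl (Sum.inl i)) (Sum.inl (Sum.inr j))
      simpa [polar, h1, Matrix.mul_apply, A, D, Pi.single_apply, Matrix.one_apply, eq_comm] using this
    have hDA : Dᵀ * A = 1 := by
      rw [← Matrix.transpose_inj, Matrix.transpose_mul, Matrix.transpose_transpose, hAD,
        Matrix.transpose_one]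
    have hAD' : A * Dᵀ = 1 := mul_eq_one_comm.1 hDA
    -- The last basis vector spans the radical of the polar form, so the last column of `M` is
    -- orthogonal to all the others. Pairing with the first block kills `f`, and pairing with the
    -- second then kills `e`.
    have hf : f = 0 := by
      have : Aᵀ *ᵥ f = 0 := by
        funext i
        have := hp (Sum.inl (Sum.inl i)) (Sum.inr 0)
        simpa [polar, h1, Matrix.mulVec, dotProduct, A, f] using this
      have h3 := congrArg (fun v => D *ᵥ v) this
      simpa [Matrix.mulVec_mulVec, mul_eq_one_comm.1 hAD] using h3
    have hf' : ∀ i, M (Sum.inl (Sum.inr i)) (Sum.inr 0) = 0 := fun i => congrFun hf i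
    have he : e = 0 := by
      have : Dᵀ *ᵥ e = 0 := by
        funext i
        have := hp (Sum.inl (Sum.inr i)) (Sum.inr 0)
        simpa [polar, hf', Matrix.mulVec, dotProduct, D, e] using this
      have h3 := congrArg (fun v => A *ᵥ v) this
      simpa [Matrix.mulVec_mulVec, hAD'] using h3
    have he' : ∀ i, M (Sum.inl (Sum.inl i)) (Sum.inr 0) = 0 := fun i => congrFun he i
    have hk : M (Sum.inr 0) (Sum.inr 0) = 1 := by
      have := ht (Sum.inr 0)
      simp only [theta, hf', mul_zero, Finset.sum_const_zero, zero_add] at this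
      rw [← CharTwo.sq_inj]
      simpa using this
    have hsymm : (Dᵀ * X).IsSymm := by
      refine Matrix.IsSymm.ext fun i j => ?_
      have := hp (Sum.inl (Sum.inr i)) (Sum.inl (Sum.inr j))
      simp only [polar, Finset.sum_add_distrib] at this
      simp only [Matrix.mul_apply, Matrix.transpose_apply]
      rw [← CharTwo.add_eq_zero]
      simpa [mul_comm, D, X] using this
    have hdiag : ∀ k, (Dᵀ * X) k k = h 0 k ^ 2 := by
      intro k
      have := ht (Sum.inl (Sum.inr k))
      rw [← CharTwo.add_eq_zero]
      simpa [theta, Matrix.mul_apply, D, X, h, mul_comm] using this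
    refine ⟨⟨A, Dᵀ, hAD', hDA⟩, Dᵀ * X, h, isAlternating_add_iff.2 ⟨hsymm, hdiag⟩, ?_⟩
    rw [levi_mul_unip]
    change M = Matrix.fromBlocks (Matrix.fromBlocks A (A * (Dᵀ * X)) 0 Dᵀᵀ) 0 _ 1
    rw [← mul_assoc, hAD', one_mul]
    ext (( i | i) | i) ((j | j) | j)
    · rfl
    · rfl
    · rw [Subsingleton.elim j 0]; exact he' i
    · exact h1 i j
    · rfl
    · rw [Subsingleton.elim j 0]; exact hf' i
    · rw [Subsingleton.elim i 0]; exact h2 j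
    · rw [Subsingleton.elim i 0]; rfl
    · rw [Subsingleton.elim i 0, Subsingleton.elim j 0]; simpa using hk

theorem toMat_injective (n : ℕ) (F : Type*) [Field F] :
    Function.Injective (toMat : O n F → Matrix (Idx n) (Idx n) F) :=
  fun _ _ h => Subtype.ext (Units.ext h)

/-- The parabolic subgroup. -/
def parabolic (n : ℕ) (F : Type*) [Field F] [Finite F] [CharP F 2] : Subgroup (O n F) where
  carrier := P n F
  one_mem' := mem_P_iff.2 ⟨fun i j => by simp [toMat], fun j => by simp [toMat]⟩
  mul_mem' {a b} ha hb := by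
    rw [mem_P_iff] at ha hb ⊢
    simp [toMat_mul, Matrix.mul_apply, ha, hb]
  inv_mem' {a} ha := by
    -- The group is finite, so an inverse is a nonnegative power and closure under products
    -- suffices.
    have hpow : ∀ k : ℕ, a ^ k ∈ P n F := by
      intro k
      induction k with
      | zero => exact mem_P_iff.2 ⟨fun i j => by simp [toMat], fun j => by simp [toMat]⟩
      | succ k ih =>
        rw [pow_succ]
        rw [mem_P_iff] at ha ih ⊢
        simp [toMat_mul, Matrix.mul_apply, ha, ih]
    have : a⁻¹ = a ^ (orderOf a - 1) := by
      rw [inv_eq_iff_mul_eq_one, ← pow_succ', Nat.sub_add_cancel (orderOf_pos a), pow_orderOf_eq_one]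
    change a⁻¹ ∈ P n F
    rw [this]
    exact hpow _

variable [Finite F]

/-- The row of square roots of the diagonal entries. -/
noncomputable def diagRow {n : ℕ} (B : Matrix (Fin n) (Fin n) F) : Matrix (Fin 1) (Fin n) F :=
  Matrix.of fun _ k => (frobeniusEquiv F 2).symm (B k k)

theorem diagRow_sq {n : ℕ} (B : Matrix (Fin n) (Fin n) F) (k : Fin n) :
    diagRow B 0 k ^ 2 = B k k :=
  frobeniusEquiv_symm_pow_p F 2 (B k k)

/-- The element of the parabolic subgroup with given linear part and symmetric part. -/
noncomputable def parElem {n : ℕ} (p : GL (Fin n) F × Sym n F) : O n F :=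
  ⟨Matrix.GeneralLinearGroup.mkOfDetNeZero (levi p.1 * unip p.2.1 (diagRow p.2.1))
    (by rw [det_levi_mul_unip]; exact one_ne_zero),
    theta_levi_mul_unip p.1
      (isAlternating_add_iff.2 ⟨p.2.2, fun k => (diagRow_sq _ k).symm⟩)⟩

theorem toMat_parElem {n : ℕ} (p : GL (Fin n) F × Sym n F) :
    toMat (parElem p) = Matrix.fromBlocks
      (Matrix.fromBlocks (p.1 : Matrix (Fin n) (Fin n) F)
        ((p.1 : Matrix (Fin n) (Fin n) F) * p.2.1) 0
        ((p.1⁻¹ : GL (Fin n) F) : Matrix (Fin n) (Fin n) F)ᵀ)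
      0 (Matrix.fromCols 0 (diagRow p.2.1)) 1 :=
  levi_mul_unip _ _ _

theorem parElem_mem {n : ℕ} (p : GL (Fin n) F × Sym n F) : parElem p ∈ parabolic n F :=
  ⟨p.1, p.2.1, diagRow p.2.1,
    isAlternating_add_iff.2 ⟨p.2.2, fun k => (diagRow_sq _ k).symm⟩, rfl⟩

theorem parElem_injective (n : ℕ) (F : Type*) [Field F] [CharP F 2] [Finite F] :
    Function.Injective (parElem : GL (Fin n) F × Sym n F → O n F) := by
  rintro ⟨A, B⟩ ⟨A', B'⟩ h
  have h' := congrArg toMat h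
  rw [toMat_parElem, toMat_parElem, Matrix.fromBlocks_inj, Matrix.fromBlocks_inj] at h'
  obtain rfl : A = A' := Units.ext h'.1.1
  have h2 := congrArg (fun X => ((A⁻¹ : GL (Fin n) F) : Matrix (Fin n) (Fin n) F) * X) h'.1.2.1
  simp only [← mul_assoc, ← Units.val_mul, inv_mul_cancel, Units.val_one, one_mul] at h2
  rw [Subtype.ext h2]

theorem exists_parElem_eq {n : ℕ} {w : O n F} (hw : w ∈ parabolic n F) :
    ∃ p, parElem p = w := by
  obtain ⟨A, B, h, hB, hw⟩ := hw
  rw [isAlternating_add_iff] at hB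
  refine ⟨(A, ⟨B, hB.1⟩), toMat_injective _ _ ?_⟩
  have : diagRow B = h := by
    ext i k
    rw [Subsingleton.elim i 0, ← CharTwo.sq_inj, diagRow_sq, hB.2]
  rw [hw, toMat_parElem, levi_mul_unip, this]

/-- Sums over the parabolic subgroup in terms of linear and symmetric parts. -/
theorem sum_parabolic {n : ℕ} [Fintype (O n F)] [DecidablePred (· ∈ parabolic n F)]
    [Fintype (GL (Fin n) F)] [Fintype (Sym n F)] {M : Type*} [AddCommMonoid M] (f : O n F → M) :
    ∑ x ∈ Finset.univ.filter (· ∈ parabolic n F), f x =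
      ∑ A : GL (Fin n) F, ∑ B : Sym n F, f (parElem (A, B)) := by
  rw [← Fintype.sum_prod_type']
  symm
  refine Finset.sum_bij (fun p _ => parElem p) ?_ ?_ ?_ ?_
  · intro p _
    simpa using parElem_mem p
  · intro p _ p' _ h
    exact parElem_injective _ _ h
  · intro w hw
    obtain ⟨p, rfl⟩ := exists_parElem_eq (Finset.mem_filter.1 hw).2
    exact ⟨p, Finset.mem_univ _, rfl⟩
  · intro p _
    rfl

end Parabolic

/-! ### Multiplication by `σ` as a permutation of rows or columns. -/

section Swap

variable {F : Type*} [Field F]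

/-- The permutation of the coordinates underlying `sigma`. -/
def swapIdx (n r : ℕ) : Idx n → Idx n
  | Sum.inl (Sum.inl i) => if i.val < r then Sum.inl (Sum.inr i) else Sum.inl (Sum.inl i)
  | Sum.inl (Sum.inr i) => if i.val < r then Sum.inl (Sum.inl i) else Sum.inl (Sum.inr i)
  | Sum.inr i => Sum.inr i

theorem sigmaMat_apply (n r : ℕ) (x y : Idx n) :
    sigmaMat n r F x y = if x = swapIdx n r y then 1 else 0 := by
  rcases x with (i | i) | i <;> rcases y with (j | j) | j <;>
    simp only [sigmaMat, swapIdx, Matrix.fromBlocks_apply₁₁, Matrix.fromBlocks_apply₁₂,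
      Matrix.fromBlocks_apply₂₁, Matrix.fromBlocks_apply₂₂, Matrix.diagonal_apply,
      Matrix.one_apply, Matrix.zero_apply] <;>
    split_ifs <;> simp_all

theorem sigmaMat_apply' (n r : ℕ) (x y : Idx n) :
    sigmaMat n r F x y = if y = swapIdx n r x then 1 else 0 := by
  rcases x with (i | i) | i <;> rcases y with (j | j) | j <;>
    simp only [sigmaMat, swapIdx, Matrix.fromBlocks_apply₁₁, Matrix.fromBlocks_apply₁₂,
      Matrix.fromBlocks_apply₂₁, Matrix.fromBlocks_apply₂₂, Matrix.diagonal_apply,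
      Matrix.one_apply, Matrix.zero_apply] <;>
    split_ifs <;> simp_all

theorem mul_sigmaMat_apply {n r : ℕ} (M : Matrix (Idx n) (Idx n) F) (x y : Idx n) :
    (M * sigmaMat n r F) x y = M x (swapIdx n r y) := by
  simp [Matrix.mul_apply, sigmaMat_apply]

theorem sigmaMat_mul_apply {n r : ℕ} (M : Matrix (Idx n) (Idx n) F) (x y : Idx n) :
    (sigmaMat n r F * M) x y = M (swapIdx n r x) y := by
  simp [Matrix.mul_apply, sigmaMat_apply']

theorem toMat_sigma (n r : ℕ) : toMat (sigma n r F) = sigmaMat n r F := rfl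

theorem sigma_inv (n r : ℕ) : (sigma n r F)⁻¹ = sigma n r F := by
  rw [inv_eq_iff_mul_eq_one]
  exact toMat_injective _ _ (sigmaMat_mul_self n r F)

end Swap

/-! ### Invertible block lower triangular matrices. -/

section LowerTriangular

theorem matrix_ext_last {m : ℕ} {R : Type*} {X Y : Matrix (Fin (m + 1)) (Fin (m + 1)) R}
    (h1 : ∀ i j : Fin m, X i.castSucc j.castSucc = Y i.castSucc j.castSucc)
    (h2 : ∀ i : Fin m, X i.castSucc (Fin.last m) = Y i.castSucc (Fin.last m))
    (h3 : ∀ j : Fin m, X (Fin.last m) j.castSucc = Y (Fin.last m) j.castSucc)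
    (h4 : X (Fin.last m) (Fin.last m) = Y (Fin.last m) (Fin.last m)) : X = Y := by
  ext i j
  refine Fin.lastCases ?_ (fun i => ?_) i <;> refine Fin.lastCases ?_ (fun j => ?_) j
  · exact h4
  · exact h3 j
  · exact h2 i
  · exact h1 i j

variable {F : Type*} [Field F] {m : ℕ}

/-- The block lower triangular matrix `[A 0; c d]`. -/
def lowTri (A : Matrix (Fin m) (Fin m) F) (c : Fin m → F) (d : F) :
    Matrix (Fin (m + 1)) (Fin (m + 1)) F :=
  Matrix.of (Fin.snoc (α := fun _ => Fin (m + 1) → F) (fun i => Fin.snoc (α := fun _ => F) (A i) 0)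
    (Fin.snoc (α := fun _ => F) c d))

@[simp] theorem lowTri_castSucc_castSucc (A : Matrix (Fin m) (Fin m) F) (c : Fin m → F) (d : F)
    (i j : Fin m) : lowTri A c d i.castSucc j.castSucc = A i j := by simp [lowTri]

@[simp] theorem lowTri_castSucc_last (A : Matrix (Fin m) (Fin m) F) (c : Fin m → F) (d : F)
    (i : Fin m) : lowTri A c d i.castSucc (Fin.last m) = 0 := by simp [lowTri]

@[simp] theorem lowTri_last_castSucc (A : Matrix (Fin m) (Fin m) F) (c : Fin m → F) (d : F)
    (j : Fin m) : lowTri A c d (Fin.last m) j.castSucc = c j := by simp [lowTri]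

@[simp] theorem lowTri_last_last (A : Matrix (Fin m) (Fin m) F) (c : Fin m → F) (d : F) :
    lowTri A c d (Fin.last m) (Fin.last m) = d := by simp [lowTri]

theorem lowTri_mul (A A' : Matrix (Fin m) (Fin m) F) (c c' : Fin m → F) (d d' : F) :
    lowTri A c d * lowTri A' c' d' = lowTri (A * A') (c ᵥ* A' + d • c') (d * d') := by
  apply matrix_ext_last <;> intros <;>
    simp [Matrix.mul_apply, Fin.sum_univ_castSucc, Matrix.vecMul, dotProduct]

theorem lowTri_one : lowTri (1 : Matrix (Fin m) (Fin m) F) 0 1 = 1 := by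
  apply matrix_ext_last <;> intros <;> simp [Matrix.one_apply, Fin.ext_iff]
  all_goals intro h
  all_goals omega

/-- The invertible block lower triangular matrices. -/
def lowTriGL (p : GL (Fin m) F × Fˣ × (Fin m → F)) : GL (Fin (m + 1)) F where
  val := lowTri p.1.val p.2.2 p.2.1
  inv := lowTri (p.1⁻¹).val (-((p.2.1⁻¹ : Fˣ) : F) • (p.2.2 ᵥ* (p.1⁻¹).val)) (p.2.1⁻¹ : Fˣ)
  val_inv := by
    rw [lowTri_mul, ← lowTri_one, ← Units.val_mul, mul_inv_cancel, ← Units.val_mul, mul_inv_cancel,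
      smul_smul]
    simp
  inv_val := by
    rw [lowTri_mul, ← lowTri_one, ← Units.val_mul, inv_mul_cancel, ← Units.val_mul, inv_mul_cancel,
      Matrix.smul_vecMul, Matrix.vecMul_vecMul, ← Units.val_mul, inv_mul_cancel]
    simp

theorem lowTriGL_inv_val (p : GL (Fin m) F × Fˣ × (Fin m → F)) :
    ((lowTriGL p)⁻¹).val = lowTri (p.1⁻¹).val
      (-((p.2.1⁻¹ : Fˣ) : F) • (p.2.2 ᵥ* (p.1⁻¹).val)) (p.2.1⁻¹ : Fˣ) := rfl

theorem lowTriGL_val (p : GL (Fin m) F × Fˣ × (Fin m → F)) :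
    (lowTriGL p).val = lowTri p.1.val p.2.2 p.2.1 := rfl

theorem lowTriGL_injective :
    Function.Injective (lowTriGL : GL (Fin m) F × Fˣ × (Fin m → F) → GL (Fin (m + 1)) F) := by
  rintro ⟨A, d, c⟩ ⟨A', d', c'⟩ h
  have h' : lowTri A.val c d = lowTri A'.val c' d' := congrArg Units.val h
  have h1 : A = A' := by
    ext i j
    simpa using congrFun (congrFun h' i.castSucc) j.castSucc
  have h2 : d = d' := by
    ext
    simpa using congrFun (congrFun h' (Fin.last m)) (Fin.last m)
  have h3 : c = c' := by
    funext j
    simpa using congrFun (congrFun h' (Fin.last m)) j.castSucc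
  rw [h1, h2, h3]

/-- Reading `A * A⁻¹ = 1` block by block, the upper left blocks are mutually inverse. Hence the last
column of `A⁻¹` also vanishes above the corner, and the corner entries are mutually inverse. -/
theorem exists_lowTriGL_eq {A : GL (Fin (m + 1)) F}
    (hA : ∀ i : Fin m, A.val i.castSucc (Fin.last m) = 0) : ∃ p, lowTriGL p = A := by
  have hmul : A.val * (A⁻¹).val = 1 := by rw [← Units.val_mul, mul_inv_cancel, Units.val_one]
  let A₁ : Matrix (Fin m) (Fin m) F := A.val.submatrix Fin.castSucc Fin.castSucc
  let A₂ : Matrix (Fin m) (Fin m) F := (A⁻¹).val.submatrix Fin.castSucc Fin.castSucc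
  have h1 : A₁ * A₂ = 1 := by
    ext i j
    have := congrFun (congrFun hmul i.castSucc) j.castSucc
    rw [Matrix.mul_apply, Fin.sum_univ_castSucc, hA, zero_mul, add_zero] at this
    simpa [Matrix.mul_apply, A₁, A₂, Matrix.one_apply] using this
  have h2 : ∀ i : Fin m, (A⁻¹).val i.castSucc (Fin.last m) = 0 := by
    have : A₁ *ᵥ (fun i => (A⁻¹).val i.castSucc (Fin.last m)) = 0 := by
      funext i
      have := congrFun (congrFun hmul i.castSucc) (Fin.last m)
      rw [Matrix.mul_apply, Fin.sum_univ_castSucc, hA, zero_mul, add_zero,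
        Matrix.one_apply_ne (Fin.castSucc_lt_last i).ne] at this
      simpa [Matrix.mulVec, dotProduct, A₁] using this
    have h3 := congrArg (fun v => A₂ *ᵥ v) this
    simp only [Matrix.mulVec_mulVec, mul_eq_one_comm.1 h1, Matrix.one_mulVec,
      Matrix.mulVec_zero] at h3
    exact fun i => congrFun h3 i
  have h3 : A.val (Fin.last m) (Fin.last m) * (A⁻¹).val (Fin.last m) (Fin.last m) = 1 := by
    have := congrFun (congrFun hmul (Fin.last m)) (Fin.last m)
    rw [Matrix.mul_apply, Fin.sum_univ_castSucc] at this
    simpa [h2] using this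
  refine ⟨⟨⟨A₁, A₂, h1, mul_eq_one_comm.1 h1⟩, ⟨_, _, h3, by rw [mul_comm]; exact h3⟩,
    fun j => A.val (Fin.last m) j.castSucc⟩, Units.ext (matrix_ext_last ?_ ?_ ?_ ?_)⟩
  all_goals intros
  all_goals simp [lowTriGL_val, A₁, hA]

/-- Sums over the block lower triangular subgroup. -/
theorem sum_lowTri [Fintype F] [DecidableEq F] [Fintype (GL (Fin m) F)]
    [Fintype (GL (Fin (m + 1)) F)]
    [DecidablePred fun A : GL (Fin (m + 1)) F => ∀ i : Fin m, A.val i.castSucc (Fin.last m) = 0]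
    {M : Type*} [AddCommMonoid M] (f : GL (Fin (m + 1)) F → M) :
    ∑ A ∈ Finset.univ.filter
        (fun A : GL (Fin (m + 1)) F => ∀ i : Fin m, A.val i.castSucc (Fin.last m) = 0), f A =
      ∑ p : GL (Fin m) F × Fˣ × (Fin m → F), f (lowTriGL p) := by
  symm
  refine Finset.sum_bij (fun p _ => lowTriGL p) ?_ ?_ ?_ ?_
  · intro p _
    simp [lowTriGL_val]
  · intro p _ p' _ h
    exact lowTriGL_injective h
  · intro w hw
    obtain ⟨p, rfl⟩ := exists_lowTriGL_eq (Finset.mem_filter.1 hw).2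
    exact ⟨p, Finset.mem_univ _, rfl⟩
  · intro p _
    rfl

end LowerTriangular

/-! ### Traces on `Pσ` and the intersection of `P` with its conjugate. -/

section Conjugate

variable {F : Type*} [Field F] {m : ℕ} [CharP F 2] [Finite F]

theorem swapIdx_inl_inl_castSucc (i : Fin m) :
    swapIdx (m + 1) m (Sum.inl (Sum.inl i.castSucc)) = Sum.inl (Sum.inr i.castSucc) := by
  simp [swapIdx]

theorem swapIdx_inl_inr_castSucc (i : Fin m) :
    swapIdx (m + 1) m (Sum.inl (Sum.inr i.castSucc)) = Sum.inl (Sum.inl i.castSucc) := by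
  simp [swapIdx]

theorem swapIdx_inl_inl_last :
    swapIdx (m + 1) m (Sum.inl (Sum.inl (Fin.last m))) = Sum.inl (Sum.inl (Fin.last m)) := by
  simp [swapIdx]

theorem swapIdx_inl_inr_last :
    swapIdx (m + 1) m (Sum.inl (Sum.inr (Fin.last m))) = Sum.inl (Sum.inr (Fin.last m)) := by
  simp [swapIdx]

/-- The trace of an element of `P σ`. -/
theorem trace_parElem_mul_sigma (A : GL (Fin (m + 1)) F) (B : Sym (m + 1) F) :
    (toMat (parElem (A, B) * sigma (m + 1) m F)).trace =
      1 + A.val (Fin.last m) (Fin.last m) + (A⁻¹).val (Fin.last m) (Fin.last m) +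
        ∑ i : Fin m, (A.val * B.1) i.castSucc i.castSucc := by
  rw [toMat_mul, toMat_sigma]
  simp only [Matrix.trace, Matrix.diag, mul_sigmaMat_apply, Fintype.sum_sum_type,
    Fin.sum_univ_castSucc, swapIdx_inl_inl_castSucc, swapIdx_inl_inl_last,
    swapIdx_inl_inr_castSucc, swapIdx_inl_inr_last, toMat_parElem]
  simp [swapIdx]
  ring

/-- When an element of `P` is conjugated by `σ` into `P`. -/
theorem conj_parElem_mem_iff (A : GL (Fin (m + 1)) F) (B : Sym (m + 1) F) :
    (sigma (m + 1) m F)⁻¹ * parElem (A, B) * sigma (m + 1) m F ∈ parabolic (m + 1) F ↔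
      (∀ i : Fin m, A.val i.castSucc (Fin.last m) = 0) ∧
        ∀ i j : Fin m, B.1 i.castSucc j.castSucc = 0 := by
  change _ ∈ P (m + 1) F ↔ _
  rw [mem_P_iff, sigma_inv]
  simp only [toMat_mul, toMat_sigma, mul_sigmaMat_apply, sigmaMat_mul_apply, Fin.forall_fin_succ',
    swapIdx_inl_inl_castSucc, swapIdx_inl_inl_last,
    swapIdx_inl_inr_castSucc, swapIdx_inl_inr_last, toMat_parElem]
  simp only [swapIdx, Matrix.fromBlocks_apply₁₁, Matrix.fromBlocks_apply₁₂,
    Matrix.fromBlocks_apply₂₁, Matrix.fromBlocks_apply₂₂, Matrix.fromCols_apply_inl,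
    Matrix.fromCols_apply_inr, Matrix.zero_apply, and_true, Matrix.transpose_apply]
  constructor
  · rintro ⟨⟨h1, -⟩, -⟩
    have hA : ∀ i : Fin m, A.val i.castSucc (Fin.last m) = 0 := fun i => (h1 i).2
    refine ⟨hA, ?_⟩
    obtain ⟨p, rfl⟩ := exists_lowTriGL_eq hA
    -- For lower triangular `A`, the upper left block of `A * B` involves only the upper left
    -- blocks, and the invertible factor cancels.
    have h2 : p.1.val * B.1.submatrix Fin.castSucc Fin.castSucc = 0 := by
      ext i j
      have := (h1 i).1 j
      rw [Matrix.mul_apply, Fin.sum_univ_castSucc] at this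
      simpa [lowTriGL_val, Matrix.mul_apply] using this
    have h3 := congrArg (fun X => (p.1⁻¹).val * X) h2
    simp only [← mul_assoc, ← Units.val_mul, inv_mul_cancel, Units.val_one, one_mul,
      mul_zero] at h3
    exact fun i j => congrFun (congrFun h3 i) j
  · rintro ⟨hA, hB⟩
    obtain ⟨p, rfl⟩ := exists_lowTriGL_eq hA
    refine ⟨⟨fun i => ⟨fun j => ?_, hA i⟩, fun i => ?_⟩, fun j => ?_⟩
    · rw [Matrix.mul_apply, Fin.sum_univ_castSucc]
      simp [lowTriGL_val, hB]
    · exact lowTri_castSucc_last _ _ _ i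
    -- The condition on the row `h` is automatic: its entries are square roots of diagonal entries
    -- of `B` that already vanish.
    · have := diagRow_sq B.1 j.castSucc
      rw [hB] at this
      exact pow_eq_zero_iff (two_ne_zero) |>.1 this

end Conjugate

/-! ### Character sums: Hamming weight, Kloosterman sum, sums over symmetric matrices. -/

section Character

variable {F : Type*} [Field F] [Algebra (ZMod 2) F]

theorem charP_two (F : Type*) [Field F] [Algebra (ZMod 2) F] : CharP F 2 :=
  charP_of_injective_algebraMap (algebraMap (ZMod 2) F).injective 2

theorem lam_apply (x : F) : lam F x = (-1) ^ (tr x).val := rfl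

theorem lam_eq (x : F) : lam F x = 1 - 2 * (if tr x ≠ 0 then 1 else 0) := by
  rw [lam_apply]
  obtain h | h : tr x = 0 ∨ tr x = 1 := by
    generalize tr x = s
    revert s
    decide
  · simp [h]
  · norm_num [h, ZMod.val_one]

/-- Each nonzero coordinate lowers the character sum from `N` by 2. -/
theorem hammingNorm_codeword {n : ℕ} (g : Fin (N n F) ≃ DC n F) (a : F) :
    (hammingNorm (codeword g a) : ℂ) =
      1 / 2 * ((N n F : ℂ) - ∑ i, lam F (a * v g i)) := by
  have h : ∑ i, lam F (a * v g i) = (N n F : ℂ) - 2 * hammingNorm (codeword g a) := by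
    simp only [lam_eq, Finset.sum_sub_distrib, ← Finset.mul_sum, Finset.sum_boole]
    simp only [hammingNorm, codeword, Finset.sum_const, Finset.card_univ, Fintype.card_fin,
      nsmul_eq_mul, mul_one]
    congr!
  rw [h]
  ring

theorem codeword_mem_dual {n : ℕ} (g : Fin (N n F) ≃ DC n F) (a : F) :
    codeword g a ∈ dual (code g) := by
  intro u hu
  have hu : ∑ i, u i • v g i = 0 := hu
  have := congrArg (fun x => tr (a * x)) hu
  simpa [tr, Finset.mul_sum, dotProduct, codeword] using this

variable [Fintype F]

/-- Squaring is an automorphism of `F` over `𝔽₂`, and the trace is invariant under such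
automorphisms. -/
theorem lam_sq (x : F) : lam F (x ^ 2) = lam F x := by
  have h : tr (x ^ 2) = tr x := by
    have := Algebra.trace_eq_of_algEquiv (FiniteField.frobeniusAlgEquivOfAlgebraic (ZMod 2) F) x
    simpa [tr, FiniteField.frobeniusAlgEquivOfAlgebraic] using this
  rw [lam_apply, lam_apply, h]

theorem eq_zero_of_lam_mul_eq_one {c : F} (h : ∀ t : F, lam F (t * c) = 1) : c = 0 := by
  by_contra hc
  obtain ⟨s, hs⟩ := Algebra.trace_surjective (ZMod 2) F 1
  have := h (s * c⁻¹)
  rw [inv_mul_cancel_right₀ hc, lam_apply, tr, hs] at this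
  norm_num [ZMod.val_one] at this

/-- The Kloosterman sum, in symmetric form. -/
theorem sum_lam_add_inv [DecidableEq F] (a : Fˣ) :
    ∑ d : Fˣ, lam F (a * (1 + d + (d⁻¹ : Fˣ))) = lam F a * kloosterman (lam F) a := by
  have := charP_two F
  -- With `d = α² a⁻¹`, the sum `a d + a d⁻¹` becomes `α² + a² α⁻² = (α + a α⁻¹)²`, and `λ` ignores
  -- the square.
  have hinj : Function.Injective fun α : Fˣ => α ^ 2 * a⁻¹ := by
    intro α β h
    have h' : (α : F) ^ 2 = (β : F) ^ 2 := by
      simpa using congrArg Units.val (mul_right_cancel h)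
    exact Units.ext (CharTwo.sq_inj.1 h')
  rw [kloosterman, Finset.mul_sum]
  symm
  refine Fintype.sum_bijective _ (Finite.injective_iff_bijective.1 hinj) _ _ fun α => ?_
  rw [← lam_sq ((α : F) + _), ← AddChar.map_add_eq_mul, CharTwo.add_sq]
  congr 1
  push_cast
  have := α.ne_zero
  have := a.ne_zero
  field_simp
  ring

/-- The linear functional `B ↦ ∑_{i ≤ m} (A B)_{ii}` on symmetric matrices. -/
def partialTrace {F : Type*} [Field F] {m : ℕ} (A : Matrix (Fin (m + 1)) (Fin (m + 1)) F) :
    Sym (m + 1) F →+ F where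
  toFun B := ∑ i : Fin m, (A * B.1) i.castSucc i.castSucc
  map_zero' := by simp
  map_add' B B' := by simp [mul_add, Finset.sum_add_distrib]

theorem partialTrace_apply {F : Type*} [Field F] {m : ℕ}
    (A : Matrix (Fin (m + 1)) (Fin (m + 1)) F) (B : Sym (m + 1) F) :
    partialTrace A B = ∑ i : Fin m, (A * B.1) i.castSucc i.castSucc := rfl

theorem sum_mul_single_castSucc {F : Type*} [Field F] {m : ℕ}
    (A : Matrix (Fin (m + 1)) (Fin (m + 1)) F) (x : Fin (m + 1)) (j : Fin m) (t : F) :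
    ∑ i : Fin m, (A * Matrix.single x j.castSucc t) i.castSucc i.castSucc =
      A j.castSucc x * t := by
  rw [Finset.sum_eq_single j]
  · simp
  · intro i _ hij
    rw [Matrix.mul_single_apply_of_ne]
    simpa using hij
  · simp

theorem sum_mul_single_last {F : Type*} [Field F] {m : ℕ}
    (A : Matrix (Fin (m + 1)) (Fin (m + 1)) F) (x : Fin (m + 1)) (t : F) :
    ∑ i : Fin m, (A * Matrix.single x (Fin.last m) t) i.castSucc i.castSucc = 0 := by
  refine Finset.sum_eq_zero fun i _ => ?_
  rw [Matrix.mul_single_apply_of_ne]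
  exact (Fin.castSucc_lt_last i).ne

theorem isSymm_single_add {F : Type*} [Field F] {n : ℕ} (i j : Fin n) (t : F) :
    (Matrix.single i j t + Matrix.single j i t).IsSymm := by
  rw [Matrix.IsSymm, Matrix.transpose_add, Matrix.transpose_single, Matrix.transpose_single,
    add_comm]

theorem isSymm_single {F : Type*} [Field F] {n : ℕ} (i : Fin n) (t : F) :
    (Matrix.single i i t).IsSymm := by
  rw [Matrix.IsSymm, Matrix.transpose_single]

/-- Testing on `t(E_{i,n} + E_{n,i})`, `t E_{ii}` and `t(E_{ij} + E_{ji})` isolates the entry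
`A_{i,n}`, the diagonal and the skew-symmetry. Conversely, an alternating matrix pairs to zero with
a symmetric one. -/
theorem lam_partialTrace_eq_one_iff {m : ℕ} (a : Fˣ)
    (A : Matrix (Fin (m + 1)) (Fin (m + 1)) F) :
    (∀ B : Sym (m + 1) F, lam F (a * partialTrace A B) = 1) ↔
      (∀ i : Fin m, A i.castSucc (Fin.last m) = 0) ∧
        IsAlternating (A.submatrix Fin.castSucc Fin.castSucc) := by
  have red : ∀ c : F, (∀ t, lam F (a * (c * t)) = 1) → c = 0 := by
    intro c h
    have : (a : F) * c = 0 := eq_zero_of_lam_mul_eq_one fun t => by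
      rw [← h t]; congr 1; ring
    simpa using this
  constructor
  · intro h
    refine ⟨fun i => red _ fun t => ?_, fun i => red _ fun t => ?_, fun i j => ?_⟩
    · have := h ⟨_, isSymm_single_add i.castSucc (Fin.last m) t⟩
      simpa [partialTrace_apply, mul_add, Finset.sum_add_distrib, sum_mul_single_castSucc,
        sum_mul_single_last] using this
    · have := h ⟨_, isSymm_single i.castSucc t⟩
      simpa [partialTrace_apply, sum_mul_single_castSucc] using this
    · rw [← add_eq_zero_iff_eq_neg]
      refine red _ fun t => ?_
      have := h ⟨_, isSymm_single_add j.castSucc i.castSucc t⟩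
      simp only [partialTrace_apply, mul_add, Matrix.add_apply, Finset.sum_add_distrib,
        sum_mul_single_castSucc] at this
      rw [← this]
      congr 1
      simp only [Matrix.submatrix_apply]
      ring
  · rintro ⟨h1, h2, h3⟩ B
    have : partialTrace A B = 0 := by
      rw [partialTrace_apply]
      simp only [Matrix.mul_apply, Fin.sum_univ_castSucc, h1, zero_mul, add_zero]
      refine sum_sum_eq_zero_of_antisymm _ (fun i => ?_) fun i j => ?_
      · have := h2 i
        rw [Matrix.submatrix_apply] at this
        rw [this, zero_mul]
      · have := h3 i j
        rw [Matrix.submatrix_apply, Matrix.submatrix_apply] at this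
        rw [this, Sym.apply_comm B i.castSucc j.castSucc]
        ring
    rw [this, mul_zero, AddChar.map_zero_eq_one]

-- Orthogonality: an additive character sums to the group order if trivial and to zero otherwise.
open Classical in
theorem sum_lam_partialTrace {m : ℕ} [Fintype (Sym (m + 1) F)] (a : Fˣ)
    (A : Matrix (Fin (m + 1)) (Fin (m + 1)) F) :
    ∑ B : Sym (m + 1) F, lam F (a * partialTrace A B) =
      if (∀ i : Fin m, A i.castSucc (Fin.last m) = 0) ∧
        IsAlternating (A.submatrix Fin.castSucc Fin.castSucc)
      then (Fintype.card (Sym (m + 1) F) : ℂ) else 0 := by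
  let ψ : AddChar (Sym (m + 1) F) ℂ :=
    (lam F).compAddMonoidHom ((AddMonoidHom.mulLeft (a : F)).comp (partialTrace A))
  have := ψ.sum_eq_ite
  rw [if_congr (P := ψ = 0) (Q := (∀ i : Fin m, A i.castSucc (Fin.last m) = 0) ∧
        IsAlternating (A.submatrix Fin.castSucc Fin.castSucc)) ?_ rfl rfl] at this
  · exact this
  · rw [← lam_partialTrace_eq_one_iff a]
    exact AddChar.eq_zero_iff

end Character

/-! ### Orders of `P` and of its intersection with a conjugate, and the character sum over `Pσ`. -/

section Counting

variable {F : Type*} [Field F]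

/-- The invertible matrices that are alternating, as nonsingular alternating matrices. -/
theorem card_gl_alternating (m : ℕ) :
    Nat.card {A : GL (Fin m) F // IsAlternating A.val} = Nat.card (AltGL F m) := by
  refine Nat.card_congr (Equiv.ofBijective (fun A => ⟨A.1.val, A.2, A.1.det.ne_zero⟩) ⟨?_, ?_⟩)
  · rintro ⟨A, hA⟩ ⟨A', hA'⟩ h
    ext1
    exact Units.ext (congrArg Subtype.val h)
  · rintro ⟨X, hX, hd⟩
    exact ⟨⟨Matrix.GeneralLinearGroup.mkOfDetNeZero X hd, hX⟩, rfl⟩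

variable [Fintype F]

/-- Symmetric matrices whose upper left block vanishes. -/
theorem card_sym_block_eq_zero (m : ℕ) :
    Nat.card {B : Sym (m + 1) F // ∀ i j : Fin m, B.1 i.castSucc j.castSucc = 0} =
      Fintype.card F ^ (m + 1) := by
  classical
  let φ : {B : Sym (m + 1) F // ∀ i j : Fin m, B.1 i.castSucc j.castSucc = 0} →
      (Fin (m + 1) → F) := fun B => B.1.1 (Fin.last m)
  have hφ : Function.Bijective φ := by
    constructor
    · rintro ⟨B, hB⟩ ⟨B', hB'⟩ h
      ext1; ext1
      have h' : ∀ j, B.1 (Fin.last m) j = B'.1 (Fin.last m) j := fun j => congrFun h j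
      refine matrix_ext_last (fun i j => ?_) (fun i => ?_) (fun j => h' _) (h' _)
      · rw [hB, hB']
      · rw [Sym.apply_comm B, Sym.apply_comm B', h']
    · intro f
      let X : Matrix (Fin (m + 1)) (Fin (m + 1)) F := Matrix.of fun i j =>
        if i = Fin.last m then f j else if j = Fin.last m then f i else 0
      have hX : X.IsSymm := Matrix.IsSymm.ext fun i j => by
        simp only [X, Matrix.of_apply]
        split_ifs <;> simp_all
      refine ⟨⟨⟨X, hX⟩, fun i j => ?_⟩, ?_⟩
      · simp [X, (Fin.castSucc_lt_last _).ne]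
      · funext j
        simp [φ, X]
  rw [Nat.card_congr (Equiv.ofBijective φ hφ)]
  simp

variable [CharP F 2]

open Classical in
theorem card_parabolic (n : ℕ) [Fintype (O n F)] :
    (Finset.univ.filter (· ∈ parabolic n F)).card =
      Nat.card (GL (Fin n) F) * Fintype.card F ^ ((n + 1).choose 2) := by
  have : Fintype (Sym n F) := Fintype.ofFinite _
  rw [Finset.card_eq_sum_ones, sum_parabolic, ← card_sym, Nat.card_eq_fintype_card,
    Nat.card_eq_fintype_card]
  simp

open Classical in
theorem card_parabolic_conj (m : ℕ) [Fintype (O (m + 1) F)] :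
    (Finset.univ.filter fun b : O (m + 1) F => b ∈ parabolic (m + 1) F ∧
      (sigma (m + 1) m F)⁻¹ * b * sigma (m + 1) m F ∈ parabolic (m + 1) F).card =
      Nat.card (GL (Fin m) F) * ((Fintype.card F - 1) * Fintype.card F ^ m) *
        Fintype.card F ^ (m + 1) := by
  have : Fintype (Sym (m + 1) F) := Fintype.ofFinite _
  rw [← Finset.filter_filter, Finset.card_filter, sum_parabolic]
  simp only [conj_parElem_mem_iff, ite_and]
  have h : ∀ A : GL (Fin (m + 1)) F,
      (∑ B : Sym (m + 1) F, if ∀ i : Fin m, A.val i.castSucc (Fin.last m) = 0 then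
        (if ∀ i j : Fin m, B.1 i.castSucc j.castSucc = 0 then 1 else 0) else 0) =
      if ∀ i : Fin m, A.val i.castSucc (Fin.last m) = 0 then Fintype.card F ^ (m + 1) else 0 := by
    intro A
    split_ifs
    · rw [← card_sym_block_eq_zero, Nat.card_eq_fintype_card, Fintype.card_subtype,
        Finset.card_filter]
    · simp
  simp only [h]
  rw [← Finset.sum_filter, sum_lowTri]
  simp [Fintype.card_units]

variable [Algebra (ZMod 2) F]

-- After summing over `B` only `A = [A₁ 0; c d]` with `A₁` alternating survives. The row `c` does
-- not enter the trace and contributes `q ^ m`, while `(A⁻¹)_nn = d⁻¹` turns the sum over `d` into a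
-- Kloosterman sum.
open Classical in
theorem sum_parabolic_lam [DecidableEq F] (m : ℕ) [Fintype (O (m + 1) F)] (a : Fˣ) :
    ∑ x ∈ Finset.univ.filter (· ∈ parabolic (m + 1) F),
        lam F (a * (toMat (x * sigma (m + 1) m F)).trace) =
      (Fintype.card F : ℂ) ^ ((m + 2).choose 2) * Nat.card (AltGL F m) *
        (Fintype.card F : ℂ) ^ m * (lam F a * kloosterman (lam F) a) := by
  have : Fintype (Sym (m + 1) F) := Fintype.ofFinite _
  rw [sum_parabolic]
  have h : ∀ A : GL (Fin (m + 1)) F,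
      ∑ B : Sym (m + 1) F, lam F (a * (toMat (parElem (A, B) * sigma (m + 1) m F)).trace) =
        if ∀ i : Fin m, A.val i.castSucc (Fin.last m) = 0 then
          (if IsAlternating (A.val.submatrix Fin.castSucc Fin.castSucc) then
            (Fintype.card (Sym (m + 1) F) : ℂ) * lam F (a * (1 + A.val (Fin.last m) (Fin.last m) +
              (A⁻¹).val (Fin.last m) (Fin.last m))) else 0) else 0 := by
    intro A
    rw [← ite_and]
    simp only [trace_parElem_mul_sigma, ← partialTrace_apply, mul_add (a : F) _ (partialTrace _ _),
      AddChar.map_add_eq_mul]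
    rw [← Finset.mul_sum, sum_lam_partialTrace, mul_ite, mul_zero, mul_comm]
    congr!
  simp only [h]
  rw [← Finset.sum_filter, sum_lowTri, Fintype.sum_prod_type]
  have hsub : ∀ (A : Matrix (Fin m) (Fin m) F) (c : Fin m → F) (d : F),
      (lowTri A c d).submatrix Fin.castSucc Fin.castSucc = A := fun A c d => by
    ext i j
    simp
  have h2 : ∀ A : GL (Fin m) F, (∑ p : Fˣ × (Fin m → F),
      if IsAlternating A.val then
        (Fintype.card (Sym (m + 1) F) : ℂ) * lam F (a * (1 + (p.1 : F) + (p.1⁻¹ : Fˣ))) else 0) =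
      if IsAlternating A.val then (Fintype.card (Sym (m + 1) F) : ℂ) *
        ((Fintype.card F : ℂ) ^ m * (lam F a * kloosterman (lam F) a)) else 0 := by
    intro A
    split_ifs
    · rw [← sum_lam_add_inv, Fintype.sum_prod_type, Finset.mul_sum, Finset.mul_sum]
      refine Finset.sum_congr rfl fun d _ => ?_
      simp
      ring
    · simp
  simp only [hsub, lowTriGL_val, lowTriGL_inv_val, lowTri_last_last, h2]
  rw [← Finset.sum_filter, Finset.sum_const, ← Fintype.card_subtype, ← Nat.card_eq_fintype_card,
    card_gl_alternating, ← Nat.card_eq_fintype_card (α := Sym (m + 1) F), card_sym]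
  simp
  ring

end Counting

/-! ### Orders of general linear groups. -/

section Arithmetic

theorem choose_two_add_two (m : ℕ) : (m + 2).choose 2 = (m + 1).choose 2 + (m + 1) := by
  rw [Nat.choose_succ_succ' (m + 1) 1, Nat.choose_one_right, add_comm]

/-- Recursion for the order of the general linear group. -/
theorem card_GL_succ (F : Type*) [Field F] [Fintype F] (m : ℕ) :
    (Nat.card (GL (Fin (m + 1)) F) : ℚ) =
      ((Fintype.card F : ℚ) ^ (m + 1) - 1) * (Fintype.card F : ℚ) ^ m *
        Nat.card (GL (Fin m) F) := by
  have hq : 1 ≤ Fintype.card F := Fintype.card_pos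
  rw [Matrix.card_GL_field, Matrix.card_GL_field, Fin.prod_univ_succ]
  simp only [Fin.val_zero, Fin.val_succ, pow_zero]
  push_cast [Nat.one_le_pow _ _ hq]
  have h : ∀ i : Fin m, (((Fintype.card F) ^ (m + 1) - (Fintype.card F) ^ (i.val + 1) : ℕ) : ℚ) =
      (Fintype.card F : ℚ) * (((Fintype.card F) ^ m - (Fintype.card F) ^ i.val : ℕ) : ℚ) := by
    intro i
    rw [pow_succ, pow_succ, ← Nat.sub_mul]
    push_cast
    ring
  simp only [h, Finset.prod_mul_distrib, Finset.prod_const, Finset.card_univ, Fintype.card_fin]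
  ring

theorem card_GL_even (F : Type*) [Field F] [Fintype F] (k : ℕ) :
    (Nat.card (GL (Fin (2 * k)) F) : ℚ) = (Fintype.card F : ℚ) ^ ((2 * k).choose 2) *
      (∏ j ∈ Finset.Icc 1 k, ((Fintype.card F : ℚ) ^ (2 * j - 1) - 1)) *
      ∏ j ∈ Finset.Icc 1 k, ((Fintype.card F : ℚ) ^ (2 * j) - 1) := by
  induction k with
  | zero => simp
  | succ k ih =>
    rw [show 2 * (k + 1) = 2 * k + 1 + 1 by ring, card_GL_succ, card_GL_succ, ih,
      Finset.prod_Icc_succ_top (by omega), Finset.prod_Icc_succ_top (by omega),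
      choose_two_add_two, show (2 * k + 1).choose 2 = (2 * k).choose 2 + 2 * k by
        rw [Nat.choose_succ_succ' (2 * k) 1, Nat.choose_one_right, add_comm],
      show 2 * (k + 1) = 2 * k + 1 + 1 by ring, Nat.add_sub_cancel, pow_add, pow_add]
    ring

end Arithmetic

/-! ### Identification of the constants and conclusion. -/

section Final

theorem one_lt_card_rat (F : Type*) [Field F] [Fintype F] : (1 : ℚ) < Fintype.card F := by
  exact_mod_cast Fintype.one_lt_card

theorem A_odd (k q : ℕ) : A (2 * k + 1) q = (q : ℚ) ^ (5 * (k * k) + 5 * k + 1) *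
    (((q : ℚ) ^ (2 * k + 1) - 1) / ((q : ℚ) - 1)) *
      ∏ j ∈ Finset.Icc 1 k, ((q : ℚ) ^ (2 * j - 1) - 1) := by
  have h1 : (5 * (2 * k + 1) ^ 2 - 1) / 4 = 5 * (k * k) + 5 * k + 1 := by
    have : 5 * (2 * k + 1) ^ 2 = 4 * (5 * (k * k) + 5 * k + 1) + 1 := by ring
    omega
  simp [A, qBinom, h1]

theorem B_odd (k q : ℕ) : B (2 * k + 1) q = (q : ℚ) ^ (k * k) * ((q : ℚ) ^ (2 * k + 1) - 1) *
      ∏ j ∈ Finset.Icc 1 k, ((q : ℚ) ^ (2 * j) - 1) := by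
  have h1 : (2 * k + 1 - 1) ^ 2 / 4 = k * k := by
    have : (2 * k + 1 - 1) ^ 2 = 4 * (k * k) := by rw [Nat.add_sub_cancel]; ring
    omega
  have h2 : (2 * k + 1 - 1) / 2 = k := by omega
  rw [B, h1, h2]

theorem choose_two_even (k : ℕ) : (2 * k).choose 2 + k = 2 * (k * k) := by
  induction k with
  | zero => rfl
  | succ k ih =>
    have h1 := choose_two_add_two (2 * k)
    have h2 : (2 * k + 1).choose 2 = 2 * k + (2 * k).choose 2 := by
      rw [Nat.choose_succ_succ' (2 * k) 1, Nat.choose_one_right]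
    rw [mul_add 2 k 1, mul_one, h1, h2]
    linarith

/-- This says that `A(n,q)` is `|P| / |P ∩ σPσ⁻¹|` times the coefficient of `λ(a)K(λ;a)` in
`sum_parabolic_lam`. -/
theorem card_conj_mul_A (F : Type*) [Field F] [Fintype F] (k : ℕ) :
    ((Nat.card (GL (Fin (2 * k)) F) * ((Fintype.card F - 1) * Fintype.card F ^ (2 * k)) *
        Fintype.card F ^ (2 * k + 1) : ℕ) : ℚ) * A (2 * k + 1) (Fintype.card F) =
      ((Nat.card (GL (Fin (2 * k + 1)) F) * Fintype.card F ^ ((2 * k + 2).choose 2) : ℕ) : ℚ) *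
        ((Fintype.card F : ℚ) ^ ((2 * k + 2).choose 2) * Nat.card (AltGL F (2 * k)) *
          (Fintype.card F : ℚ) ^ (2 * k)) := by
  have hq := one_lt_card_rat F
  have hq' : (Fintype.card F : ℚ) - 1 ≠ 0 := by linarith
  have hq1 : 1 ≤ Fintype.card F := Fintype.card_pos
  push_cast [hq1]
  rw [A_odd, card_GL_succ, card_altGL_two_mul]
  -- `he`, `hc` and `hkk` make the exponents linear in `k` and `k * k`, so that `omega` can compare
  -- them despite truncated subtraction.
  have he : k * (k - 1) + k = k * k := by
    cases k with
    | zero => rfl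
    | succ j => rw [Nat.add_sub_cancel]; ring
  have hc := choose_two_even (k + 1)
  have hkk : (k + 1) * (k + 1) = k * k + 2 * k + 1 := by ring
  rw [mul_add 2 k 1, mul_one] at hc
  have hx : (Fintype.card F : ℚ) ^ (2 * k) * (Fintype.card F : ℚ) ^ (2 * k + 1) *
      (Fintype.card F : ℚ) ^ (5 * (k * k) + 5 * k + 1) =
      (Fintype.card F : ℚ) ^ (2 * k) * (Fintype.card F : ℚ) ^ ((2 * k + 2).choose 2) *
        (Fintype.card F : ℚ) ^ ((2 * k + 2).choose 2) * (Fintype.card F : ℚ) ^ (k * (k - 1)) *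
        (Fintype.card F : ℚ) ^ (2 * k) := by
    simp only [← pow_add]
    congr 1
    omega
  have hd : ((Fintype.card F : ℚ) - 1) *
      (((Fintype.card F : ℚ) ^ (2 * k + 1) - 1) / ((Fintype.card F : ℚ) - 1)) =
        (Fintype.card F : ℚ) ^ (2 * k + 1) - 1 := mul_div_cancel₀ _ hq'
  generalize ((Fintype.card F : ℚ) ^ (2 * k + 1) - 1) / ((Fintype.card F : ℚ) - 1) = d at hd ⊢
  linear_combination (Nat.card (GL (Fin (2 * k)) F) * (Fintype.card F : ℚ) ^ (2 * k) *
    (Fintype.card F : ℚ) ^ (2 * k + 1) * (Fintype.card F : ℚ) ^ (5 * (k * k) + 5 * k + 1) *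
    ∏ j ∈ Finset.Icc 1 k, ((Fintype.card F : ℚ) ^ (2 * j - 1) - 1)) * hd + (Nat.card (GL (Fin (2 * k)) F) *
    ((Fintype.card F : ℚ) ^ (2 * k + 1) - 1) *
    ∏ j ∈ Finset.Icc 1 k, ((Fintype.card F : ℚ) ^ (2 * j - 1) - 1)) * hx

/-- This says that `B(n,q)` is `|P|` divided by that same coefficient. Behind it is `|GL(2k,q)|`
over the number of nonsingular alternating matrices, which is the order `q^{k²} ∏ (q^{2j} - 1)` of
the symplectic group. -/
theorem altGL_mul_B (F : Type*) [Field F] [Fintype F] (k : ℕ) :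
    (Fintype.card F : ℚ) ^ ((2 * k + 2).choose 2) * Nat.card (AltGL F (2 * k)) *
        (Fintype.card F : ℚ) ^ (2 * k) * B (2 * k + 1) (Fintype.card F) =
      ((Nat.card (GL (Fin (2 * k + 1)) F) * Fintype.card F ^ ((2 * k + 2).choose 2) : ℕ) : ℚ) := by
  push_cast
  rw [B_odd, card_GL_succ, card_altGL_two_mul, card_GL_even]
  have he : k * (k - 1) + k = k * k := by
    cases k with
    | zero => rfl
    | succ j => rw [Nat.add_sub_cancel]; ring
  have hc := choose_two_even k
  have hx : (Fintype.card F : ℚ) ^ ((2 * k).choose 2) =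
      (Fintype.card F : ℚ) ^ (k * (k - 1)) * (Fintype.card F : ℚ) ^ (k * k) := by
    rw [← pow_add]
    congr 1
    omega
  rw [hx]
  ring

variable {F : Type*} [Field F] [Fintype F] [DecidableEq F] [Algebra (ZMod 2) F]

/-- The cardinality of the double coset and the character sum of the trace over it. -/
theorem card_and_sum_DC (k : ℕ) (a : Fˣ) (g : Fin (N (2 * k + 1) F) ≃ DC (2 * k + 1) F) :
    (N (2 * k + 1) F : ℂ) = (A (2 * k + 1) (Fintype.card F) : ℂ) * B (2 * k + 1) (Fintype.card F) ∧
      ∑ i, lam F (a * v g i) =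
        (A (2 * k + 1) (Fintype.card F) : ℂ) * (lam F a * kloosterman (lam F) a) := by
  classical
  have := charP_two F
  have : Fintype (O (2 * k + 1) F) := Fintype.ofFinite _
  have hsum : ∀ f : O (2 * k + 1) F → ℂ, ∑ i, f (g i) =
      ∑ w ∈ Finset.univ.filter (· ∈ DoubleCoset.doubleCoset (sigma (2 * k + 1) (2 * k) F)
        (parabolic (2 * k + 1) F : Set (O (2 * k + 1) F)) (parabolic (2 * k + 1) F)), f w := by
    intro f
    rw [g.sum_comp (fun w => f w)]
    symm
    -- The closing `rfl` uses that `2 * k + 1 - 1` reduces to `2 * k` and that the carrier of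
    -- `parabolic` is `P`.
    exact Finset.sum_subtype _ (fun w => by
      simp only [Finset.mem_filter, Finset.mem_univ, true_and]; rfl) f
  have key : ∀ f : O (2 * k + 1) F → ℂ, (∀ x y, f (x * y) = f (y * x)) → _ := fun f hf =>
    card_mul_sum_doubleCoset (parabolic (2 * k + 1) F) (sigma (2 * k + 1) (2 * k) F) f hf
  simp only [← hsum, card_parabolic_conj, card_parabolic] at key
  have hA := congrArg (Rat.cast : ℚ → ℂ) (card_conj_mul_A F k)
  have hB := congrArg (Rat.cast : ℚ → ℂ) (altGL_mul_B F k)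
  have hne : ((Nat.card (GL (Fin (2 * k)) F) * ((Fintype.card F - 1) * Fintype.card F ^ (2 * k)) *
        Fintype.card F ^ (2 * k + 1) : ℕ) : ℂ) ≠ 0 := by
    have h1 : Nat.card (GL (Fin (2 * k)) F) ≠ 0 := Nat.card_pos.ne'
    have h2 : Fintype.card F ≠ 0 := Fintype.card_ne_zero
    have h3 : Fintype.card F - 1 ≠ 0 := by
      have := Fintype.one_lt_card (α := F)
      omega
    exact_mod_cast by positivity
  rw [Rat.cast_mul, Rat.cast_natCast, Rat.cast_mul, Rat.cast_natCast] at hA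
  rw [Rat.cast_mul, Rat.cast_natCast] at hB
  constructor
  -- The constant function gives the length, as `|P|² / |P ∩ σPσ⁻¹|`.
  · have h := key (fun _ => 1) fun _ _ => rfl
    rw [Finset.sum_const, Finset.sum_const, Finset.card_univ, Fintype.card_fin, card_parabolic,
      nsmul_eq_mul, mul_one, nsmul_eq_mul, mul_one] at h
    refine mul_left_cancel₀ hne ?_
    rw [h, ← mul_assoc, hA, mul_assoc, hB]
  · have h := key (fun w => lam F (a * (toMat w).trace)) fun x y => by
      rw [toMat_mul, toMat_mul, Matrix.trace_mul_comm]
    rw [sum_parabolic_lam] at h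
    refine mul_left_cancel₀ hne ?_
    refine h.trans ?_
    rw [← mul_assoc _ (A (2 * k + 1) (Fintype.card F) : ℂ), hA]
    push_cast
    ring

end Final

end OddOrthogonalCode

theorem mainTheorem6 {F : Type*} [Field F] [Fintype F] [DecidableEq F] [Algebra (ZMod 2) F]
    (n : ℕ) (hn : Odd n)
    (g : Fin (OddOrthogonalCode.N n F) ≃ OddOrthogonalCode.DC n F) (a : Fˣ) :
    OddOrthogonalCode.codeword g (a : F) ∈
        OddOrthogonalCode.dual (OddOrthogonalCode.code g) ∧
      (hammingNorm (OddOrthogonalCode.codeword g (a : F)) : ℂ) =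
        1 / 2 * (OddOrthogonalCode.A n (Fintype.card F) : ℂ) *
          ((OddOrthogonalCode.B n (Fintype.card F) : ℂ) -
            OddOrthogonalCode.lam F (a : F) *
              OddOrthogonalCode.kloosterman (OddOrthogonalCode.lam F) a) := by
  refine ⟨OddOrthogonalCode.codeword_mem_dual g a, ?_⟩
  obtain ⟨k, rfl⟩ := hn
  obtain ⟨h1, h2⟩ := OddOrthogonalCode.card_and_sum_DC k a g
  rw [OddOrthogonalCode.hammingNorm_codeword, h1, h2]
  ring
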